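/- Let $n\ge 1$ and let $\mathrm{conv}(\mathbb R^n)$ be the space of nonempty compact convex subsets of $\mathbb R^n$ with the Hausdorff metric. Identify $u\in\mathrm{conv}(\mathbb R^n)$ with its support function $h_u(p)=\sup_{x\in u}(x,p)$. Let $V[u]$ be the volume, $V[u_1,\dots,u_n]$ Minkowski's mixed volume, and $V_1[u,v]=V[u,\dots,u,v]$. Let $A$ be a linear operator on $\mathbb R^n$, put $\exp\{\mathcal A c\}u=e^{cA}u$, and let $\varphi:\mathbb R_+\to\mathbb R_+$ and $F:\mathbb R_+\times\mathrm{conv}(\mathbb R^n)\to\mathrm{conv}(\mathbb R^n)$ be locally Lipschitz. Let $G\subset\mathrm{conv}(\mathbb R^n)$ be closed with $\{0\}\in G$, and let $\mathfrak F$ be a global semiflow on $G$: for all $u\in G$ and $t,s\ge 0$ one has $\mathfrak F^t(u)\in G$, $\mathfrak F^0(u)=u$, $\mathfrak F^t(\mathfrak F^s(u))=\mathfrak F^{t+s}(u)$, and $\mathfrak F^t(u)$ is continuous in $t\ge0$ for fixed $u$ and continuous in $u\in G$ for fixed $t$. Suppose that $\mathfrak F^t(\{0\})=\{0\}$ for $t\ge0$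 and that, for each $u_0\in G$, $u(t)=\mathfrak F^t(u_0)$ satisfies for all $t\ge 0$ $$u(t)=\exp\Big\{\mathcal A\int_0^t\varphi(V[u(s)])\,ds\Big\}u_0+\int_0^t\exp\Big\{\mathcal A\int_s^t\varphi(V[u(\tau)])\,d\tau\Big\}F(V[u(s)],u(s))\,ds .$$ Let $k\ge 1$, $W_0=V$, and let $W_1,\dots,W_k:\mathrm{conv}(\mathbb R^n)\to\mathbb R$ be nonnegative on $G$ and differentiable along the orbits of $\mathfrak F$ in $G$, in the sense that for $u\in G$ the function $t\mapsto W_i[\mathfrak F^t(u)]$ is continuous on $[0,\infty)$ and has a right derivative $\frac{dW_i[\mathfrak F^t(u)]}{dt}\big|_{t=0}$ at $0$. Let $f_i:\mathbb R_+^{i+1}\to\mathbb R$ and $\psi_i:\mathbb R_+^{i}\to\mathbb R$ $(1\le i\le k)$ be continuous, and suppose that for all $u\in G$ $$nV_1[u,F(V[u],u)]\le\psi_1(V[u])\,W_1[u],$$ $$\frac{dW_i[\mathfrak F^t(u)]}{dt}\Big|_{t=0}\le f_i(V[u],W_1[u],\dots,W_i[u])+\psi_{i+1}(V[u],W_1[u],\dots,W_i[u])\,W_{i+1}[u],\quad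 1\le i\le k-1,$$ $$\frac{dW_k[\mathfrak F^t(u)]}{dt}\Big|_{t=0}\le f_k(V[u],W_1[u],\dots,W_k[u]).$$ Consider in the cone $\mathbb R_+^{k+1}$ the comparison system $$\xi_0'=\operatorname{tr}A\,\varphi(\xi_0)\xi_0+\psi_1(\xi_0)\xi_1,\qquad \xi_i'=f_i(\xi_0,\dots,\xi_i)+\psi_{i+1}(\xi_0,\dots,\xi_i)\xi_{i+1}\ (1\le i\le k-1),\qquad \xi_k'=f_k(\xi_0,\dots,\xi_k). \tag{$*$}$$ Suppose that its right-hand sides satisfy the Ważewski condition in $\mathbb R_+^{k+1}$ (the $i$-th one is nondecreasing in each $\xi_j$, $j\ne i$) and that $\xi=0$ is a solution. The zero solution of $(*)$ is called $\xi_0$-stable in $\mathbb R_+^{k+1}$ if for every $\varepsilon>0$ there is $\delta>0$ such that all solutions in the cone with $\xi_i(0)>0$ for all $i$ and $\max_i\xi_i(0)<\delta$ exist for all $t\ge0$ (every such solution on a bounded interval $[0,T)$ extends to a solution on $[0,\infty)$) and satisfy $\xi_0(t)<\varepsilon$ for all $t\ge 0$. It is called asymptotically $\xi_0$-stable if, moreover,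 there is $\rho>0$ such that $\xi_0(t)\to0$ as $t\to+\infty$ for all such solutions on $[0,\infty)$ with $\max_i\xi_i(0)<\rho$. Let $h_0[u]=\max_{0\le i\le k}W_i[u]$. (1) If the zero solution of $(*)$ is $\xi_0$-stable in $\mathbb R_+^{k+1}$, then $\mathfrak F$ is stable in the measures $(h_0,V)$: for every $\varepsilon>0$ there is $\delta>0$ such that, for $u\in G$, $h_0[u]<\delta$ implies $V[\mathfrak F^t(u)]<\varepsilon$ for all $t\ge0$. (2) If the zero solution of $(*)$ is asymptotically $\xi_0$-stable in $\mathbb R_+^{k+1}$, then $\mathfrak F$ is asymptotically stable in the measures $(h_0,V)$: it is stable as in (1), and there is $\rho>0$ such that, for $u\in G$, $h_0[u]<\rho$ implies $V[\mathfrak F^t(u)]\to0$ as $t\to+\infty$. -/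

import Mathlib

open Set Filter Topology MeasureTheory

namespace ConvSemiflow

/-- The metric space `conv(ℝⁿ)` of nonempty compact convex subsets of `ℝⁿ`, with Minkowski addition,
multiplication by scalars and the Hausdorff metric (all of these are Mathlib's). -/
abbrev Conv (n : ℕ) : Type := ConvexBody (EuclideanSpace ℝ (Fin n))

/-- The volume `V[u]`. -/
noncomputable def vol {n : ℕ} (u : Conv n) : ℝ :=
  (volume (u : Set (EuclideanSpace ℝ (Fin n)))).toReal

/-- Minkowski's mixed volume `V[u₁, …, uₙ]`, that is, the symmetric coefficients in
`V[∑ λₖ uₖ] = ∑ V[u_{k₁}, …, u_{kₙ}] λ_{k₁} ⋯ λ_{kₙ}`, written out by polarization: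
`n! V[u₁, …, uₙ] = ∑_S (-1)^(n - |S|) V[∑_{i ∈ S} uᵢ]`, over all subsets `S` of `{1, …, n}`. -/
noncomputable def mixedVolume {n : ℕ} (u : Fin n → Conv n) : ℝ :=
  ((n.factorial : ℝ))⁻¹ * ∑ S : Finset (Fin n), (-1 : ℝ) ^ (n - S.card) * vol (∑ i ∈ S, u i)

/-- `V_m[u, v] = V[u, …, u, v, …, v]`, with `v` in the last `m` of the `n` places. -/
noncomputable def mixedVol {n : ℕ} (m : ℕ) (u v : Conv n) : ℝ :=
  mixedVolume (fun i : Fin n => if (i : ℕ) + m < n then u else v)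

/-- The support function `h_u(p) = sup_{x ∈ u} (x, p)`. -/
noncomputable def supp {n : ℕ} (u : Conv n) (p : EuclideanSpace ℝ (Fin n)) : ℝ :=
  sSup ((fun x : EuclideanSpace ℝ (Fin n) => inner ℝ x p) '' (u : Set (EuclideanSpace ℝ (Fin n))))

/-- The image of a convex compact under a linear map. -/
def linImage {n : ℕ} (L : EuclideanSpace ℝ (Fin n) →L[ℝ] EuclideanSpace ℝ (Fin n))
    (u : Conv n) : Conv n where
  carrier := L '' (u : Set (EuclideanSpace ℝ (Fin n)))
  convex' := u.convex.linear_image L.toLinearMap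
  isCompact' := u.isCompact.image L.continuous
  nonempty' := u.nonempty.image L

/-- The semiflow `exp{𝒜 c} u = e^{cA} u` on `conv(ℝⁿ)`. -/
noncomputable def expFlow {n : ℕ} (A : EuclideanSpace ℝ (Fin n) →L[ℝ] EuclideanSpace ℝ (Fin n))
    (c : ℝ) (u : Conv n) : Conv n :=
  linImage (NormedSpace.exp (c • A)) u

/-- `u : [0, ∞) → conv(ℝⁿ)` is a continuous solution, with initial value `u₀`, of
`u(t) = exp{𝒜 ∫₀ᵗ φ(V[u(s)]) ds} u₀ + ∫₀ᵗ exp{𝒜 ∫ₛᵗ φ(V[u(τ)]) dτ} F(V[u(s)], u(s)) ds`.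
Convex compacts are identified with their support functions, and the equation is one between
continuous functions of `p`; the integrand is continuous in `s`. -/
def SolvesIntegralEq {n : ℕ} (A : EuclideanSpace ℝ (Fin n) →L[ℝ] EuclideanSpace ℝ (Fin n))
    (φ : ℝ → ℝ) (F : ℝ → Conv n → Conv n) (u₀ : Conv n) (u : ℝ → Conv n) : Prop :=
  ContinuousOn u (Ici 0) ∧
  ∀ t : ℝ, 0 ≤ t → ∀ p : EuclideanSpace ℝ (Fin n),
    supp (u t) p =
      supp (expFlow A (∫ s in (0 : ℝ)..t, φ (vol (u s))) u₀) p +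
      ∫ s in (0 : ℝ)..t,
        supp (expFlow A (∫ τ in s..t, φ (vol (u τ))) (F (vol (u s)) (u s))) p

/-- `Φ` (with `Φ t u` for `𝔉ᵗ(u)`) is a global semiflow on the subset `G` of a metric space. -/
structure IsGlobalSemiflowOn {X : Type*} [MetricSpace X] (G : Set X) (Φ : ℝ → X → X) : Prop where
  mapsTo : ∀ t : ℝ, 0 ≤ t → ∀ u ∈ G, Φ t u ∈ G
  zero : ∀ u ∈ G, Φ 0 u = u
  add : ∀ t₁ t₂ : ℝ, 0 ≤ t₁ → 0 ≤ t₂ → ∀ u ∈ G, Φ t₁ (Φ t₂ u) = Φ (t₁ + t₂) u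
  continuous_time : ∀ u ∈ G, ContinuousOn (fun t => Φ t u) (Ici 0)
  continuous_space : ∀ t : ℝ, 0 ≤ t → ContinuousOn (Φ t) G

/-- `(h₀, h)`-stability of the semiflow `Φ` on `G`. -/
def StableInMeasures {X : Type*} (G : Set X) (Φ : ℝ → X → X) (h₀ h : X → ℝ) : Prop :=
  ∀ ε : ℝ, 0 < ε → ∃ δ : ℝ, 0 < δ ∧ ∀ u ∈ G, h₀ u < δ → ∀ t : ℝ, 0 ≤ t → h (Φ t u) < ε

/-- Asymptotic `(h₀, h)`-stability of the semiflow `Φ` on `G`. -/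
def AsympStableInMeasures {X : Type*} (G : Set X) (Φ : ℝ → X → X) (h₀ h : X → ℝ) : Prop :=
  StableInMeasures G Φ h₀ h ∧
  ∃ ρ : ℝ, 0 < ρ ∧ ∀ u ∈ G, h₀ u < ρ → Tendsto (fun t => h (Φ t u)) atTop (𝓝 0)

/-- The derivative `dW[𝔉ᵗ(u)]/dt` at `t = 0` (from the right). -/
noncomputable def orbitDeriv {X : Type*} (Φ : ℝ → X → X) (W : X → ℝ) (u : X) : ℝ :=
  derivWithin (fun t => W (Φ t u)) (Ici 0) 0

/-- `W` is differentiable along the orbits of the semiflow `Φ` on `G`: along each orbit it is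
continuous in time, and the right derivative at time `0` exists (so, by the semigroup property, the
right derivative exists at all times). -/
def DifferentiableAlongOrbits {X : Type*} (G : Set X) (Φ : ℝ → X → X) (W : X → ℝ) : Prop :=
  ∀ u ∈ G, ContinuousOn (fun t => W (Φ t u)) (Ici 0) ∧
    DifferentiableWithinAt ℝ (fun t => W (Φ t u)) (Ici 0) 0

/-- The cone `ℝ₊^m`. -/
def cone (m : ℕ) : Set (Fin m → ℝ) := {x | ∀ i, 0 ≤ x i}

/-- The initial segment `(ξ₀, …, ξᵢ)` of `ξ = (ξ₀, …, ξₖ)`. -/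
def initSeg {k : ℕ} (ξ : Fin (k + 1) → ℝ) (i : Fin (k + 1)) : Fin ((i : ℕ) + 1) → ℝ :=
  fun j => ξ ⟨(j : ℕ), by omega⟩

/-- The right-hand sides of the comparison system (for `k ≥ 1`, with `a = tr A`)
* `ξ₀' = a φ(ξ₀) ξ₀ + ψ₁(ξ₀) ξ₁`,
* `ξᵢ' = fᵢ(ξ₀, …, ξᵢ) + ψᵢ₊₁(ξ₀, …, ξᵢ) ξᵢ₊₁` for `1 ≤ i ≤ k - 1`,
* `ξₖ' = fₖ(ξ₀, …, ξₖ)`.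
Only `f₁, …, fₖ` and `ψ₁, …, ψₖ` occur. -/
noncomputable def compRHS (k : ℕ) (a : ℝ) (φ : ℝ → ℝ) (f : (i : ℕ) → (Fin (i + 1) → ℝ) → ℝ)
    (ψ : (i : ℕ) → (Fin i → ℝ) → ℝ) (ξ : Fin (k + 1) → ℝ) (i : Fin (k + 1)) : ℝ :=
  (if i = 0 then a * φ (ξ 0) * ξ 0 else f i (initSeg ξ i)) +
  (if h : (i : ℕ) < k then
    ψ ((i : ℕ) + 1) (initSeg ξ i) * ξ ⟨(i : ℕ) + 1, Nat.succ_lt_succ h⟩ else 0)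

/-- The Ważewski condition on the cone: the `i`-th right-hand side is nondecreasing in each `ξⱼ`,
`j ≠ i`. -/
def Wazewski {m : ℕ} (g : (Fin m → ℝ) → Fin m → ℝ) : Prop :=
  ∀ i : Fin m, ∀ x ∈ cone m, ∀ y ∈ cone m, x ≤ y → x i = y i → g x i ≤ g y i

/-- `ξ` is a solution of `ξ' = g(ξ)` in the cone on the time interval `I` (one-sided derivatives at
end points that belong to `I`). -/
def IsSolutionOn {m : ℕ} (g : (Fin m → ℝ) → Fin m → ℝ) (I : Set ℝ) (ξ : ℝ → Fin m → ℝ) : Prop :=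
  ∀ t ∈ I, ξ t ∈ cone m ∧ HasDerivWithinAt ξ (g (ξ t)) I t

/-- The zero solution of `ξ' = g(ξ)` is `ξ₀`-stable in the cone: for every `ε > 0` there is `δ > 0`
such that the solutions with `ξ(0) > 0` (in each component) and `‖ξ(0)‖_∞ < δ` exist for all
`t ≥ 0` (that is, each solution on a bounded interval `[0, T)` extends to `[0, ∞)`) and satisfy
`ξ₀(t) < ε` for all `t ≥ 0`. -/
def XiZeroStable {k : ℕ} (g : (Fin (k + 1) → ℝ) → Fin (k + 1) → ℝ) : Prop :=
  ∀ ε : ℝ, 0 < ε → ∃ δ : ℝ, 0 < δ ∧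
    (∀ (T : ℝ) (ξ : ℝ → Fin (k + 1) → ℝ), 0 < T → IsSolutionOn g (Ico 0 T) ξ →
      (∀ i, 0 < ξ 0 i) → ‖ξ 0‖ < δ →
        ∃ η : ℝ → Fin (k + 1) → ℝ, IsSolutionOn g (Ici 0) η ∧ EqOn η ξ (Ico 0 T)) ∧
    (∀ ξ : ℝ → Fin (k + 1) → ℝ, IsSolutionOn g (Ici 0) ξ →
      (∀ i, 0 < ξ 0 i) → ‖ξ 0‖ < δ → ∀ t : ℝ, 0 ≤ t → ξ t 0 < ε)

/-- The zero solution of `ξ' = g(ξ)` is asymptotically `ξ₀`-stable in the cone. -/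
def AsympXiZeroStable {k : ℕ} (g : (Fin (k + 1) → ℝ) → Fin (k + 1) → ℝ) : Prop :=
  XiZeroStable g ∧
  ∃ ρ : ℝ, 0 < ρ ∧ ∀ ξ : ℝ → Fin (k + 1) → ℝ, IsSolutionOn g (Ici 0) ξ →
    (∀ i, 0 < ξ 0 i) → ‖ξ 0‖ < ρ → Tendsto (fun t => ξ t 0) atTop (𝓝 0)

/-- The measure of initial deviations `h₀[u] = max_{0 ≤ i ≤ k} Wᵢ[u]`. -/
noncomputable def maxMeasure {X : Type*} (k : ℕ) (W : ℕ → X → ℝ) (u : X) : ℝ :=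
  (Finset.univ : Finset (Fin (k + 1))).sup' Finset.univ_nonempty (fun i => W i u)

end ConvSemiflow

open ConvSemiflow

/-!
The core is the inequality `dV[u(t)]/dt ≤ tr A φ(V) V + n V₁[u, F]` along an orbit, in the sense of
the upper right Dini derivative. The integral equation gives
`u(t + h) ⊆ e^{hφA}(u(t) + h (F + o(1)))`, a transport which multiplies the volume by the trace
exponential, so one differentiates `V[u + h L]` at `h = 0`. This requires Minkowski's theorem that
`V[u + h L]` is a polynomial in `h`. It is proved by transport: if `X` and `Y` are the log-Laplace
transforms of finite measures with supports `u` and `L`, then `∇X + h ∇Y` maps `ℝⁿ` injectively onto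
`u + h L` up to a null set, and its Jacobian determinant is a polynomial in `h` at every point.

The right-hand sides of the comparison system are only continuous, so its solutions need not be
unique. Stability therefore is not tested on an arbitrary solution but on one which stays strictly
above `t ↦ W[Φᵗ(u)]`: Peano's theorem and the Ważewski condition continue such a solution past
any finite time, and Zorn's lemma makes it global.
-/

namespace ConvSemiflow

section LogLaplace

open ProbabilityTheory
open scoped RealInnerProductSpace

lemma exists_isFiniteMeasure_support_eq {X : Type*} [TopologicalSpace X]
    [SecondCountableTopology X] [MeasurableSpace X] [OpensMeasurableSpace X] {K : Set X}
    (hK : IsClosed K) : ∃ ν : Measure X, IsFiniteMeasure ν ∧ ν.support = K := by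
  obtain ⟨D, hD, hDense⟩ := TopologicalSpace.exists_countable_dense K
  have := hD.to_subtype
  let μ : Measure X := Measure.sum fun x : D => Measure.dirac ((x : K) : X)
  have hμK : K ∈ ae μ := by
    refine mem_ae_iff.2 ((Measure.sum_apply_eq_zero' hK.measurableSet.compl).2 fun x => ?_)
    simp [hK.measurableSet.compl]
  refine ⟨μ.toFinite, inferInstance, Subset.antisymm ?_ fun x hx => ?_⟩
  · exact ((absolutelyContinuous_toFinite μ).support_mono.antisymm
      (toFinite_absolutelyContinuous μ).support_mono).ge.trans
      (Measure.support_subset_of_isClosed hK hμK)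
  · refine (absolutelyContinuous_toFinite μ).support_mono
      ((Measure.mem_support_iff_forall x).2 fun U hU => ?_)
    obtain ⟨y, hyU, hyD⟩ := mem_closure_iff_nhds.1 (hDense ⟨x, hx⟩) (Subtype.val ⁻¹' U)
      (continuous_subtype_val.continuousAt hU)
    calc (0 : ENNReal) < Measure.dirac (y : X) U := by
          rw [Measure.dirac_apply_of_mem (mem_preimage.1 hyU)]; exact one_pos
      _ ≤ μ U := Measure.le_sum (fun x : D => Measure.dirac ((x : K) : X)) ⟨y, hyD⟩ U

lemma exists_pos_le_measureReal_ball {X : Type*} [PseudoMetricSpace X] [MeasurableSpace X]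
    {ν : Measure X} [IsFiniteMeasure ν] (hK : IsCompact ν.support) {δ : ℝ} (hδ : 0 < δ) :
    ∃ c > 0, ∀ x ∈ ν.support, c ≤ ν.real (Metric.ball x δ) := by
  refine hK.induction_on (p := fun s => ∃ c > 0, ∀ x ∈ s, c ≤ ν.real (Metric.ball x δ))
    ⟨1, one_pos, by simp⟩ ?_ ?_ fun x hx => ?_
  · rintro s t hst ⟨c, hc, hct⟩
    exact ⟨c, hc, fun x hx => hct x (hst hx)⟩
  · rintro s t ⟨c, hc, hcs⟩ ⟨d, hd, hdt⟩
    refine ⟨min c d, lt_min hc hd, ?_⟩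
    rintro x (hx | hx)
    exacts [(min_le_left c d).trans (hcs x hx), (min_le_right c d).trans (hdt x hx)]
  · refine ⟨Metric.ball x (δ / 2),
      mem_nhdsWithin_of_mem_nhds (Metric.ball_mem_nhds x (by positivity)),
      ν.real (Metric.ball x (δ / 2)), ?_, fun y hy => measureReal_mono ?_⟩
    · exact ENNReal.toReal_pos ((Measure.mem_support_iff_forall x).1 hx _
        (Metric.ball_mem_nhds x (by positivity))).ne' (measure_ne_top _ _)
    · refine Metric.ball_subset_ball' ?_
      rw [dist_comm]
      linarith [Metric.mem_ball.1 hy]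

variable {E : Type*} [NormedAddCommGroup E] [InnerProductSpace ℝ E]
  [MeasurableSpace E] {ν : Measure E}

/-- The Laplace transform `Z(p) = ∫ e^⟪x, p⟫ dν(x)` of a measure. -/
noncomputable def laplaceTransform (ν : Measure E) (p : E) : ℝ := ∫ x, Real.exp ⟪x, p⟫ ∂ν

/-- The mean of the exponentially tilted measure `Z(p)⁻¹ e^⟪x, p⟫ dν(x)`; it is the gradient of
`log Z` at `p`. -/
noncomputable def tiltedMean (ν : Measure E) (p : E) : E := ∫ x, x ∂ν.tilted (⟪·, p⟫)

lemma tiltedMean_eq_inv_laplaceTransform_smul (ν : Measure E) (p : E) :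
    tiltedMean ν p = (laplaceTransform ν p)⁻¹ • ∫ x, Real.exp ⟪x, p⟫ • x ∂ν := by
  rw [tiltedMean, integral_tilted, ← integral_smul]
  simp only [laplaceTransform, smul_smul, div_eq_inv_mul]

lemma isCompact_support_tilted {X : Type*} [TopologicalSpace X] [MeasurableSpace X]
    {ν : Measure X} (hK : IsCompact ν.support) (f : X → ℝ) : IsCompact (ν.tilted f).support :=
  hK.of_isClosed_subset Measure.isClosed_support (tilted_absolutelyContinuous ν f).support_mono

variable [BorelSpace E] [FiniteDimensional ℝ E]

lemma integrable_of_isCompact_support [IsFiniteMeasure ν] (hK : IsCompact ν.support)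
    {F : Type*} [NormedAddCommGroup F] {g : E → F} (hg : Continuous g) : Integrable g ν := by
  rw [← Measure.restrict_eq_self_of_ae_mem (Measure.support_mem_ae (μ := ν))]
  exact hg.continuousOn.integrableOn_compact hK

lemma hasFDerivAt_integral_exp_inner_smul [IsFiniteMeasure ν] (hK : IsCompact ν.support)
    {F : Type*} [NormedAddCommGroup F] [NormedSpace ℝ F] {g : E → F} (hg : Continuous g) (p : E) :
    HasFDerivAt (fun q => ∫ x, Real.exp ⟪x, q⟫ • g x ∂ν)
      (∫ x, Real.exp ⟪x, p⟫ • (innerSL ℝ x).smulRight (g x) ∂ν) p := by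
  have hg' : Continuous fun x => (innerSL ℝ x).smulRight (g x) :=
    ((ContinuousLinearMap.smulRightL ℝ E F).continuous.comp (innerSL ℝ).continuous).clm_apply hg
  have hball : IsCompact (ν.support ×ˢ Metric.closedBall p 1) :=
    hK.prod (isCompact_closedBall p 1)
  obtain ⟨C, hC⟩ := hball.exists_bound_of_continuousOn
    (f := fun z => Real.exp ⟪z.1, z.2⟫ • (innerSL ℝ z.1).smulRight (g z.1))
    ((Real.continuous_exp.comp continuous_inner).smul
      (hg'.comp continuous_fst)).continuousOn
  refine hasFDerivAt_integral_of_dominated_of_fderiv_le (𝕜 := ℝ)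
    (F' := fun q x => Real.exp ⟪x, q⟫ • (innerSL ℝ x).smulRight (g x)) (bound := fun _ => C)
    (Metric.ball_mem_nhds p one_pos) (Eventually.of_forall fun q => ?_) ?_ ?_ ?_
    (integrable_const C) (Eventually.of_forall fun x q _ => ?_)
  · exact (integrable_of_isCompact_support hK (by fun_prop)).aestronglyMeasurable
  · exact integrable_of_isCompact_support hK (by fun_prop)
  · exact (integrable_of_isCompact_support hK (by fun_prop)).aestronglyMeasurable
  · filter_upwards [Measure.support_mem_ae (μ := ν)] with x hx q hq
    exact hC (x, q) ⟨hx, Metric.ball_subset_closedBall hq⟩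
  · have h := HasFDerivAt.exp (f := fun q => ⟪x, q⟫) (innerSL ℝ x).hasFDerivAt (x := q)
    convert h.smul_const (g x) using 1
    ext1 v
    simp [smul_smul]

lemma laplaceTransform_pos [IsFiniteMeasure ν] [NeZero ν] (hK : IsCompact ν.support) (p : E) :
    0 < laplaceTransform ν p :=
  integral_exp_pos (integrable_of_isCompact_support hK (by fun_prop))

lemma hasFDerivAt_log_laplaceTransform [IsFiniteMeasure ν] [NeZero ν] (hK : IsCompact ν.support)
    (p : E) :
    HasFDerivAt (fun p => Real.log (laplaceTransform ν p)) (innerSL ℝ (tiltedMean ν p)) p := by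
  have hZ : HasFDerivAt (laplaceTransform ν)
      (∫ x, Real.exp ⟪x, p⟫ • (innerSL ℝ x).smulRight (1 : ℝ) ∂ν) p := by
    simpa only [laplaceTransform, smul_eq_mul, mul_one] using!
      hasFDerivAt_integral_exp_inner_smul hK (continuous_const (y := (1 : ℝ))) p
  convert hZ.log (laplaceTransform_pos hK p).ne' using 1
  rw [tiltedMean_eq_inv_laplaceTransform_smul, map_smul]
  congr 1
  rw [← (innerSL ℝ).integral_comp_comm (integrable_of_isCompact_support hK (by fun_prop))]
  congr! 2 with x
  exact ContinuousLinearMap.ext fun v => by simp; rfl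

lemma differentiable_tiltedMean [IsFiniteMeasure ν] [NeZero ν] (hK : IsCompact ν.support) :
    Differentiable ℝ (tiltedMean ν) := by
  have hZ : Differentiable ℝ (laplaceTransform ν) := fun p => by
    simpa only [laplaceTransform, smul_eq_mul, mul_one] using!
      (hasFDerivAt_integral_exp_inner_smul hK (continuous_const (y := (1 : ℝ))) p).differentiableAt
  have hM : Differentiable ℝ fun p => ∫ x, Real.exp ⟪x, p⟫ • x ∂ν := fun p =>
    (hasFDerivAt_integral_exp_inner_smul hK continuous_id p).differentiableAt
  rw [funext (tiltedMean_eq_inv_laplaceTransform_smul ν)]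
  exact (hZ.inv fun p => (laplaceTransform_pos hK p).ne').smul hM

lemma inner_tiltedMean [IsFiniteMeasure ν] (hK : IsCompact ν.support) (p v : E) :
    ⟪tiltedMean ν p, v⟫ = ∫ x, ⟪x, v⟫ ∂ν.tilted (⟪·, p⟫) := by
  simp only [real_inner_comm v]
  exact ((innerSL ℝ v).integral_comp_comm
    (integrable_of_isCompact_support (isCompact_support_tilted hK _) continuous_id)).symm

lemma tiltedMean_mem_support [IsFiniteMeasure ν] [NeZero ν] (hK : IsCompact ν.support)
    (hc : Convex ℝ ν.support) (p : E) : tiltedMean ν p ∈ ν.support := by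
  have := isProbabilityMeasure_tilted (μ := ν) (f := (⟪·, p⟫))
    (integrable_of_isCompact_support hK (by fun_prop))
  exact hc.integral_mem Measure.isClosed_support
    ((tilted_absolutelyContinuous ν _).ae_le Measure.support_mem_ae)
    (integrable_of_isCompact_support (isCompact_support_tilted hK _) continuous_id)

lemma inner_fderiv_tiltedMean_eq_variance [IsFiniteMeasure ν] [NeZero ν]
    (hK : IsCompact ν.support) (p v : E) :
    ⟪fderiv ℝ (tiltedMean ν) p v, v⟫ = Var[(⟪·, v⟫); ν.tilted (⟪·, p⟫)] := by
  have hdom : ∀ t, t ∈ interior (integrableExpSet (⟪·, v⟫) (ν.tilted (⟪·, p⟫))) := fun t =>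
    mem_interior_iff_mem_nhds.2 (univ_mem' fun s =>
      integrable_of_isCompact_support (isCompact_support_tilted hK _) (by fun_prop))
  have hcgf : deriv (cgf (⟪·, v⟫) (ν.tilted (⟪·, p⟫))) =
      fun t => ⟪tiltedMean ν (p + t • v), v⟫ := by
    funext t
    rw [← integral_tilted_mul_self (hdom t), inner_tiltedMean hK,
      tilted_tilted (integrable_of_isCompact_support hK (by fun_prop))]
    simp only [Pi.add_def, inner_add_right, inner_smul_right]
  have hline : HasDerivAt (fun t : ℝ => p + t • v) v 0 := by
    simpa using ((hasDerivAt_id (0 : ℝ)).smul_const v).const_add p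
  have hmean : HasDerivAt (fun t : ℝ => tiltedMean ν (p + t • v))
      (fderiv ℝ (tiltedMean ν) p v) 0 := by
    have hp : HasFDerivAt (tiltedMean ν) (fderiv ℝ (tiltedMean ν) p) (p + (0 : ℝ) • v) := by
      simpa using (differentiable_tiltedMean hK p).hasFDerivAt
    exact hp.comp_hasDerivAt 0 hline
  have hvar := variance_tilted_mul (hdom 0)
  rw [iteratedDeriv_succ, iteratedDeriv_one, hcgf, (hmean.inner ℝ (hasDerivAt_const 0 v)).deriv,
    tilted_tilted (integrable_of_isCompact_support hK (by fun_prop))] at hvar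
  simpa [Pi.add_def] using hvar.symm

lemma inner_fderiv_tiltedMean_nonneg [IsFiniteMeasure ν] [NeZero ν] (hK : IsCompact ν.support)
    (p v : E) : 0 ≤ ⟪fderiv ℝ (tiltedMean ν) p v, v⟫ := by
  rw [inner_fderiv_tiltedMean_eq_variance hK]
  exact variance_nonneg _ _

lemma inner_fderiv_tiltedMean_pos [IsFiniteMeasure ν] [NeZero ν] (hK : IsCompact ν.support)
    (p : E) {v x y : E} (hx : x ∈ ν.support) (hy : y ∈ ν.support) (hxy : ⟪x, v⟫ ≠ ⟪y, v⟫) :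
    0 < ⟪fderiv ℝ (tiltedMean ν) p v, v⟫ := by
  refine (inner_fderiv_tiltedMean_nonneg hK p v).lt_of_ne fun h0 => hxy ?_
  rw [inner_fderiv_tiltedMean_eq_variance hK] at h0
  have := isProbabilityMeasure_tilted (μ := ν) (f := (⟪·, p⟫))
    (integrable_of_isCompact_support hK (by fun_prop))
  have hbdd : MemLp (⟪·, v⟫) 2 (ν.tilted (⟪·, p⟫)) :=
    (memLp_two_iff_integrable_sq (by fun_prop)).2
      (integrable_of_isCompact_support (isCompact_support_tilted hK _) (by fun_prop))
  have hae : ∀ᵐ z ∂ν, ⟪z, v⟫ = ∫ z, ⟪z, v⟫ ∂ν.tilted (⟪·, p⟫) :=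
    (absolutelyContinuous_tilted (integrable_of_isCompact_support hK (by fun_prop))).ae_le
      (ae_eq_integral_of_variance_eq_zero hbdd h0.symm)
  have hconst := Measure.support_subset_of_isClosed
    (isClosed_eq (by fun_prop) continuous_const) hae
  exact (hconst hx).trans (hconst hy).symm

lemma log_laplaceTransform_ge_of_measureReal_ball_ge [IsFiniteMeasure ν] (hK : IsCompact ν.support)
    {x : E} {δ c : ℝ} (hc : 0 < c) (hcx : c ≤ ν.real (Metric.ball x δ)) (p : E) :
    ⟪x, p⟫ - δ * ‖p‖ + Real.log c ≤ Real.log (laplaceTransform ν p) := by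
  have hint : Integrable (fun y : E => Real.exp ⟪y, p⟫) ν :=
    integrable_of_isCompact_support hK (by fun_prop)
  have hball : ∀ y ∈ Metric.ball x δ, ⟪x, p⟫ - δ * ‖p‖ ≤ ⟪y, p⟫ := fun y hy => by
    have hxy : ⟪x - y, p⟫ ≤ δ * ‖p‖ := (real_inner_le_norm _ _).trans
      (mul_le_mul_of_nonneg_right (mem_ball_iff_norm'.1 hy).le (norm_nonneg p))
    rw [inner_sub_left] at hxy
    linarith
  have key : Real.exp (⟪x, p⟫ - δ * ‖p‖) * c ≤ laplaceTransform ν p :=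
    calc Real.exp (⟪x, p⟫ - δ * ‖p‖) * c
        ≤ Real.exp (⟪x, p⟫ - δ * ‖p‖) * ν.real (Metric.ball x δ) := by gcongr
      _ = ∫ _ in Metric.ball x δ, Real.exp (⟪x, p⟫ - δ * ‖p‖) ∂ν := by simp [mul_comm]
      _ ≤ ∫ y in Metric.ball x δ, Real.exp ⟪y, p⟫ ∂ν :=
          setIntegral_mono_on (integrable_const _).integrableOn hint.integrableOn
            measurableSet_ball fun y hy => Real.exp_le_exp.2 (hball y hy)
      _ ≤ laplaceTransform ν p :=
          setIntegral_le_integral hint (Eventually.of_forall fun y => (Real.exp_pos _).le)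
  calc ⟪x, p⟫ - δ * ‖p‖ + Real.log c = Real.log (Real.exp (⟪x, p⟫ - δ * ‖p‖) * c) := by
        rw [Real.log_mul (Real.exp_pos _).ne' hc.ne', Real.log_exp]
    _ ≤ Real.log (laplaceTransform ν p) := Real.log_le_log (by positivity) key

end LogLaplace

section MinkowskiPolynomial

open Polynomial
open scoped Pointwise RealInnerProductSpace

/-- The Lagrange basis polynomials for the nodes `1, …, d + 1`; the node `0` is left out because
Minkowski's polynomial is first obtained for positive arguments only. -/
noncomputable def lagrangeWeight (d i : ℕ) : ℝ[X] :=
  Lagrange.basis (Finset.range (d + 1)) (fun j : ℕ => (j : ℝ) + 1) i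

lemma natDegree_lagrangeWeight_le {d i : ℕ} (hi : i ∈ Finset.range (d + 1)) :
    (lagrangeWeight d i).natDegree ≤ d := by
  have h := Lagrange.natDegree_basis (v := fun j : ℕ => (j : ℝ) + 1)
    (fun a _ b _ hab => by simpa using hab) hi
  simpa [lagrangeWeight] using h.le

lemma eval_eq_sum_lagrangeWeight {d : ℕ} {P : ℝ[X]} (hP : P.natDegree ≤ d) (h : ℝ) :
    P.eval h =
      ∑ i ∈ Finset.range (d + 1), P.eval ((i : ℝ) + 1) * (lagrangeWeight d i).eval h := by
  have hdeg : P.degree < (Finset.range (d + 1)).card :=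
    (degree_le_of_natDegree_le hP).trans_lt (by simpa using Nat.cast_lt.2 d.lt_succ_self)
  conv_lhs => rw [Lagrange.eq_interpolate (v := fun j : ℕ => (j : ℝ) + 1)
    (fun a _ b _ hab => by simpa using hab) hdeg]
  simp only [Lagrange.interpolate_apply, eval_finsetSum, eval_mul, eval_C, lagrangeWeight]

lemma exists_polynomial_eval_eq_integral {α : Type*} [MeasurableSpace α] {μ : Measure α} {d : ℕ}
    {F : ℝ → α → ℝ} (hint : ∀ h : ℝ, 0 < h → Integrable (F h) μ)
    (hF : ∀ a, ∃ P : ℝ[X], P.natDegree ≤ d ∧ ∀ h, P.eval h = F h a) :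
    ∃ P : ℝ[X], P.natDegree ≤ d ∧ ∀ h, P.eval h = ∫ a, F h a ∂μ := by
  refine ⟨∑ i ∈ Finset.range (d + 1), C (∫ a, F (i + 1) a ∂μ) * lagrangeWeight d i,
    natDegree_sum_le_of_forall_le _ _ fun i hi =>
      (natDegree_C_mul_le _ _).trans (natDegree_lagrangeWeight_le hi), fun h => ?_⟩
  have hsum : ∀ a, F h a =
      ∑ i ∈ Finset.range (d + 1), F (i + 1) a * (lagrangeWeight d i).eval h := fun a => by
    obtain ⟨P, hPd, hP⟩ := hF a
    simpa only [hP] using eval_eq_sum_lagrangeWeight hPd h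
  simp_rw [hsum, eval_finsetSum, eval_mul, eval_C]
  rw [integral_finsetSum (f := fun (i : ℕ) a => F (i + 1) a * (lagrangeWeight d i).eval h) _
    fun i _ => (hint (i + 1) (by positivity)).mul_const _]
  simp only [integral_mul_const]

variable {E : Type*} [NormedAddCommGroup E] [InnerProductSpace ℝ E]

lemma injective_of_inner_fderiv_pos {T : E → E} (hT : Differentiable ℝ T)
    (hpos : ∀ p v, v ≠ 0 → 0 < ⟪fderiv ℝ T p v, v⟫) : Function.Injective T := by
  intro p q hpq
  by_contra hne
  have hline : ∀ s : ℝ, HasDerivAt (fun s : ℝ => q + s • (p - q)) (p - q) s := fun s => by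
    simpa using ((hasDerivAt_id s).smul_const (p - q)).const_add q
  have hderiv : ∀ s : ℝ, HasDerivAt (fun s : ℝ => ⟪T (q + s • (p - q)), p - q⟫)
      ⟪fderiv ℝ T (q + s • (p - q)) (p - q), p - q⟫ s := fun s => by
    simpa using ((hT _).hasFDerivAt.comp_hasDerivAt s (hline s)).inner ℝ
      (hasDerivAt_const s (p - q))
  have hlt := strictMono_of_hasDerivAt_pos hderiv
    (fun s => hpos _ _ (sub_ne_zero.2 hne)) zero_lt_one
  simp [hpq] at hlt

variable [FiniteDimensional ℝ E]

lemma exists_polynomial_det_add_smul (M N : E →L[ℝ] E) :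
    ∃ P : ℝ[X], P.natDegree ≤ Module.finrank ℝ E ∧ ∀ h : ℝ, P.eval h = (M + h • N).det := by
  let b := Module.finBasis ℝ E
  let A := LinearMap.toMatrix b b (N : E →ₗ[ℝ] E)
  let B := LinearMap.toMatrix b b (M : E →ₗ[ℝ] E)
  refine ⟨Matrix.det ((X : ℝ[X]) • A.map C + B.map C),
    by simpa using natDegree_det_X_add_C_le A B, fun h => ?_⟩
  have hdet : (M + h • N).det = (h • A + B).det := by
    rw [← map_smul, ← map_add, LinearMap.det_toMatrix, add_comm]
    rfl
  rw [hdet, ← coe_evalRingHom, RingHom.map_det]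
  congr 1
  ext i j
  simp only [coe_evalRingHom, RingHom.mapMatrix_apply, Matrix.map_apply, Matrix.add_apply,
    Matrix.smul_apply, smul_eq_mul, eval_add, eval_mul, eval_X, eval_C]

lemma det_pos_of_inner_pos {L : E →L[ℝ] E} (hL : ∀ v, v ≠ 0 → 0 < ⟪L v, v⟫) : 0 < L.det := by
  let M : ℝ → E →L[ℝ] E := fun s => s • L + (1 - s) • ContinuousLinearMap.id ℝ E
  have hM : Continuous fun s => (M s).det :=
    ContinuousLinearMap.continuous_det.comp (by fun_prop)
  have hne : ∀ s ∈ Icc (0 : ℝ) 1, (M s).det ≠ 0 := by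
    rintro s ⟨hs0, hs1⟩ hdet
    obtain ⟨v, hv, hv0⟩ := Submodule.exists_mem_ne_zero_of_ne_bot
      (LinearMap.bot_lt_ker_of_det_eq_zero (f := (M s : E →ₗ[ℝ] E)) hdet).ne'
    have hzero : s * ⟪L v, v⟫ + (1 - s) * ⟪v, v⟫ = 0 := by
      calc s * ⟪L v, v⟫ + (1 - s) * ⟪v, v⟫ = ⟪M s v, v⟫ := by
            simp [M, inner_add_left, inner_smul_left]
        _ = 0 := by rw [show M s v = 0 from hv, inner_zero_left]
    rcases hs0.eq_or_lt with rfl | hs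
    · linarith [real_inner_self_pos.2 hv0]
    · have hnonneg : 0 ≤ (1 - s) * ⟪v, v⟫ := mul_nonneg (sub_nonneg.2 hs1) real_inner_self_nonneg
      linarith [mul_pos hs (hL v hv0)]
  have h0 : (M 0).det = 1 := by simp [M, ContinuousLinearMap.det]
  have h1 : (M 1).det = L.det := by simp [M]
  by_contra! hcon
  obtain ⟨s, hs, hs0⟩ := intermediate_value_Icc' zero_le_one hM.continuousOn
    (show (0 : ℝ) ∈ Icc (M 1).det (M 0).det from ⟨h1 ▸ hcon, h0 ▸ zero_le_one⟩)
  exact hne s hs hs0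

variable [MeasurableSpace E] [BorelSpace E]

lemma measure_interior_of_convex (μ : Measure E) [μ.IsAddHaarMeasure] {s : Set E}
    (hs : Convex ℝ s) : μ (interior s) = μ s :=
  measure_interior_of_null_frontier (hs.addHaar_frontier μ)

lemma measure_eq_zero_of_inner_const (μ : Measure E) [μ.IsAddHaarMeasure] {s : Set E}
    (hs : Convex ℝ s) {v : E} (hv : v ≠ 0) (hsv : ∀ x ∈ s, ∀ y ∈ s, ⟪v, x⟫ = ⟪v, y⟫) :
    μ s = 0 := by
  rw [← measure_interior_of_convex μ hs]
  suffices interior s = ∅ by simp [this]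
  by_contra! hne
  obtain ⟨y, hy⟩ := hne
  have hlocal : innerSL ℝ v =ᶠ[𝓝 y] fun _ => ⟪v, y⟫ := by
    filter_upwards [mem_interior_iff_mem_nhds.1 hy] with x hx
    exact hsv x hx y (interior_subset hy)
  have hzero : innerSL ℝ v = 0 :=
    (innerSL ℝ v).hasFDerivAt.unique ((hasFDerivAt_const _ y).congr_of_eventuallyEq hlocal)
  exact hv (inner_self_eq_zero.1 (DFunLike.congr_fun hzero v))

lemma exists_le_log_laplaceTransform {ν : Measure E} [IsFiniteMeasure ν]
    (hν : IsCompact ν.support) {δ : ℝ} (hδ : 0 < δ) :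
    ∃ C : ℝ, ∀ p, ∀ x ∈ ν.support, ⟪x, p⟫ - δ * ‖p‖ + C ≤ Real.log (laplaceTransform ν p) := by
  obtain ⟨c, hc, hball⟩ := exists_pos_le_measureReal_ball hν hδ
  exact ⟨Real.log c, fun p x hx =>
    log_laplaceTransform_ge_of_measureReal_ball_ge hν hc (hball x hx) p⟩

variable {ν ν' : Measure E} [IsFiniteMeasure ν] [IsFiniteMeasure ν']
  (hν : IsCompact ν.support) (hν' : IsCompact ν'.support)
include hν hν'

lemma tendsto_log_laplaceTransform_sub_inner_cocompact {h : ℝ} (hh : 0 < h) {y : E}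
    (hy : y ∈ interior (ν.support + h • ν'.support)) :
    Tendsto (fun p => Real.log (laplaceTransform ν p) + h * Real.log (laplaceTransform ν' p) -
      ⟪y, p⟫) (cocompact E) atTop := by
  obtain ⟨r, hr, hball⟩ := Metric.nhds_basis_closedBall.mem_iff.1 (mem_interior_iff_mem_nhds.1 hy)
  have hδ : 0 < r / (2 * (1 + h)) := by positivity
  obtain ⟨C, hC⟩ := exists_le_log_laplaceTransform hν hδ
  obtain ⟨C', hC'⟩ := exists_le_log_laplaceTransform hν' hδ
  have hbound : ∀ p, r / 2 * ‖p‖ + (C + h * C') ≤ Real.log (laplaceTransform ν p) +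
      h * Real.log (laplaceTransform ν' p) - ⟪y, p⟫ := fun p => by
    have hnorm : r / ‖p‖ * ‖p‖ ^ 2 = r * ‖p‖ := by
      rcases eq_or_ne ‖p‖ 0 with hp | hp
      · simp [hp]
      · field_simp
    have hz : y + (r / ‖p‖) • p ∈ ν.support + h • ν'.support := by
      refine hball (mem_closedBall_iff_norm.2 ?_)
      rw [add_sub_cancel_left, norm_smul, norm_div, norm_norm, Real.norm_of_nonneg hr.le]
      rcases eq_or_ne ‖p‖ 0 with hp | hp
      · simpa [hp] using hr.le
      · exact (div_mul_cancel₀ r hp).le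
    obtain ⟨a, ha, -, ⟨b, hb, rfl⟩, hab⟩ := hz
    have hsum : ⟪a, p⟫ + h * ⟪b, p⟫ = ⟪y, p⟫ + r * ‖p‖ := by
      simpa [inner_add_left, inner_smul_left, hnorm] using
        congrArg (fun z => ⟪z, p⟫) hab
    have hsplit : r / (2 * (1 + h)) * ‖p‖ + h * (r / (2 * (1 + h)) * ‖p‖) = r / 2 * ‖p‖ := by
      field_simp
    linarith [hC p a ha, mul_le_mul_of_nonneg_left (hC' p b hb) hh.le]
  exact tendsto_atTop_mono hbound (tendsto_atTop_add_const_right _ _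
    (tendsto_norm_cocompact_atTop.const_mul_atTop (by positivity)))

variable [NeZero ν] [NeZero ν']

lemma differentiable_tiltedMean_add_smul (h : ℝ) :
    Differentiable ℝ fun p => tiltedMean ν p + h • tiltedMean ν' p :=
  (differentiable_tiltedMean hν).add ((differentiable_tiltedMean hν').const_smul h)

lemma fderiv_tiltedMean_add_smul (h : ℝ) (p : E) :
    fderiv ℝ (fun p => tiltedMean ν p + h • tiltedMean ν' p) p =
      fderiv ℝ (tiltedMean ν) p + h • fderiv ℝ (tiltedMean ν') p :=
  ((differentiable_tiltedMean hν p).hasFDerivAt.add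
    ((differentiable_tiltedMean hν' p).hasFDerivAt.const_smul h)).fderiv

/-- The point `p` is a minimum of the convex function whose gradient is
`p ↦ tiltedMean ν p + h • tiltedMean ν' p - y`. -/
lemma exists_tiltedMean_add_smul_eq {h : ℝ} (hh : 0 < h) {y : E}
    (hy : y ∈ interior (ν.support + h • ν'.support)) :
    ∃ p, tiltedMean ν p + h • tiltedMean ν' p = y := by
  have hgrad : ∀ p, HasFDerivAt (fun p => Real.log (laplaceTransform ν p) +
      h * Real.log (laplaceTransform ν' p) - ⟪y, p⟫)
      (innerSL ℝ (tiltedMean ν p) + h • innerSL ℝ (tiltedMean ν' p) - innerSL ℝ y) p := fun p =>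
    ((hasFDerivAt_log_laplaceTransform hν p).add
      ((hasFDerivAt_log_laplaceTransform hν' p).const_mul h)).sub (innerSL ℝ y).hasFDerivAt
  obtain ⟨p, hp⟩ := (continuous_iff_continuousAt.2 fun p =>
    (hgrad p).continuousAt).exists_forall_le
      (tendsto_log_laplaceTransform_sub_inner_cocompact hν hν' hh hy)
  have hzero := IsLocalMin.hasFDerivAt_eq_zero (Eventually.of_forall hp) (hgrad p)
  refine ⟨p, ext_inner_right ℝ fun v => ?_⟩
  have hv := DFunLike.congr_fun hzero v
  simpa [inner_add_left, inner_smul_left, innerSL_apply_apply, sub_eq_zero] using! hv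

lemma measure_range_tiltedMean_add_smul (μ : Measure E) [μ.IsAddHaarMeasure]
    (hc : Convex ℝ ν.support) (hc' : Convex ℝ ν'.support) {h : ℝ} (hh : 0 < h) :
    μ (range fun p => tiltedMean ν p + h • tiltedMean ν' p) =
      μ (ν.support + h • ν'.support) := by
  refine le_antisymm (measure_mono ?_) ?_
  · rintro _ ⟨p, rfl⟩
    exact add_mem_add (tiltedMean_mem_support hν hc p)
      (smul_mem_smul_set (tiltedMean_mem_support hν' hc' p))
  · rw [← measure_interior_of_convex μ (hc.add (hc'.smul h))]
    exact measure_mono fun y hy => exists_tiltedMean_add_smul_eq hν hν' hh hy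

lemma inner_fderiv_tiltedMean_add_smul_pos {h : ℝ} (hh : 0 < h) (p : E) {v : E}
    (hv : ¬ ((∀ x ∈ ν.support, ∀ y ∈ ν.support, ⟪x, v⟫ = ⟪y, v⟫) ∧
      ∀ x ∈ ν'.support, ∀ y ∈ ν'.support, ⟪x, v⟫ = ⟪y, v⟫)) :
    0 < ⟪(fderiv ℝ (tiltedMean ν) p + h • fderiv ℝ (tiltedMean ν') p) v, v⟫ := by
  simp only [_root_.add_apply, _root_.smul_apply, inner_add_left,
    inner_smul_left, conj_trivial]
  have hnonneg := inner_fderiv_tiltedMean_nonneg hν p v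
  have hnonneg' := inner_fderiv_tiltedMean_nonneg hν' p v
  rcases not_and_or.1 hv with hν_const | hν'_const
  · push Not at hν_const
    obtain ⟨x, hx, y, hy, hxy⟩ := hν_const
    have := inner_fderiv_tiltedMean_pos hν p hx hy hxy
    positivity
  · push Not at hν'_const
    obtain ⟨x, hx, y, hy, hxy⟩ := hν'_const
    have := inner_fderiv_tiltedMean_pos hν' p hx hy hxy
    positivity

lemma measureReal_support_add_smul_eq_integral_det (μ : Measure E) [μ.IsAddHaarMeasure]
    (hc : Convex ℝ ν.support) (hc' : Convex ℝ ν'.support) {h : ℝ} (hh : 0 < h)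
    (hpos : ∀ p v, v ≠ 0 →
      0 < ⟪(fderiv ℝ (tiltedMean ν) p + h • fderiv ℝ (tiltedMean ν') p) v, v⟫) :
    Integrable (fun p => (fderiv ℝ (tiltedMean ν) p + h • fderiv ℝ (tiltedMean ν') p).det) μ ∧
      ∫ p, (fderiv ℝ (tiltedMean ν) p + h • fderiv ℝ (tiltedMean ν') p).det ∂μ =
        μ.real (ν.support + h • ν'.support) := by
  simp only [← fderiv_tiltedMean_add_smul hν hν'] at hpos ⊢
  set T : E → E := fun p => tiltedMean ν p + h • tiltedMean ν' p
  have hT : Differentiable ℝ T := differentiable_tiltedMean_add_smul hν hν' h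
  have hdet : ∀ p, 0 < (fderiv ℝ T p).det := fun p => det_pos_of_inner_pos (hpos p)
  have hmeas : Measurable fun p => (fderiv ℝ T p).det :=
    ContinuousLinearMap.continuous_det.measurable.comp (measurable_fderiv ℝ T)
  have hlintegral : ∫⁻ p, ENNReal.ofReal (fderiv ℝ T p).det ∂μ =
      μ (ν.support + h • ν'.support) := by
    rw [← measure_range_tiltedMean_add_smul hν hν' μ hc hc' hh, ← image_univ,
      ← lintegral_abs_det_fderiv_eq_addHaar_image μ MeasurableSet.univ
        (fun p _ => (hT p).hasFDerivAt.hasFDerivWithinAt)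
        (injective_of_inner_fderiv_pos hT hpos).injOn, Measure.restrict_univ]
    simp only [fun p => abs_of_pos (hdet p)]
  refine ⟨⟨hmeas.aestronglyMeasurable, ?_⟩, ?_⟩
  · rw [hasFiniteIntegral_iff_ofReal (Eventually.of_forall fun p => (hdet p).le), hlintegral]
    exact (hν.add (hν'.smul h)).measure_lt_top
  · rw [integral_eq_lintegral_of_nonneg_ae (Eventually.of_forall fun p => (hdet p).le)
      hmeas.aestronglyMeasurable, hlintegral, Measure.real]

omit hν hν' in
theorem exists_polynomial_measureReal_add_smul (μ : Measure E) [μ.IsAddHaarMeasure] {K L : Set E}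
    (hK : IsCompact K) (hKne : K.Nonempty) (hKc : Convex ℝ K)
    (hL : IsCompact L) (hLne : L.Nonempty) (hLc : Convex ℝ L) :
    ∃ P : ℝ[X], P.natDegree ≤ Module.finrank ℝ E ∧ ∀ h > 0, P.eval h = μ.real (K + h • L) := by
  by_cases hflat : ∃ v : E, v ≠ 0 ∧ (∀ x ∈ K, ∀ y ∈ K, ⟪x, v⟫ = ⟪y, v⟫) ∧
      ∀ x ∈ L, ∀ y ∈ L, ⟪x, v⟫ = ⟪y, v⟫
  · obtain ⟨v, hv, hKv, hLv⟩ := hflat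
    refine ⟨0, by simp, fun h _ => ?_⟩
    have hnull : μ (K + h • L) = 0 := by
      refine measure_eq_zero_of_inner_const μ (hKc.add (hLc.smul h)) hv ?_
      rintro _ ⟨a, ha, _, ⟨b, hb, rfl⟩, rfl⟩ _ ⟨a', ha', _, ⟨b', hb', rfl⟩, rfl⟩
      simp only [real_inner_comm _ v, inner_add_left, inner_smul_left, hKv a ha a' ha',
        hLv b hb b' hb']
    simp [Measure.real, hnull]
  · obtain ⟨ν, _, rfl⟩ := exists_isFiniteMeasure_support_eq hK.isClosed
    obtain ⟨ν', _, rfl⟩ := exists_isFiniteMeasure_support_eq hL.isClosed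
    have : NeZero ν := ⟨Measure.nonempty_support_iff.1 hKne⟩
    have : NeZero ν' := ⟨Measure.nonempty_support_iff.1 hLne⟩
    have hpos : ∀ h : ℝ, 0 < h → ∀ p v, v ≠ 0 →
        0 < ⟪(fderiv ℝ (tiltedMean ν) p + h • fderiv ℝ (tiltedMean ν') p) v, v⟫ :=
      fun h hh p v hv => inner_fderiv_tiltedMean_add_smul_pos hK hL hh p fun hconst =>
        hflat ⟨v, hv, hconst⟩
    obtain ⟨P, hPd, hP⟩ := exists_polynomial_eval_eq_integral (μ := μ)
      (fun h hh => (measureReal_support_add_smul_eq_integral_det hK hL μ hKc hLc hh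
        (hpos h hh)).1)
      fun p => exists_polynomial_det_add_smul _ _
    exact ⟨P, hPd, fun h hh => (hP h).trans
      (measureReal_support_add_smul_eq_integral_det hK hL μ hKc hLc hh (hpos h hh)).2⟩

end MinkowskiPolynomial

section OperatorExponential

variable {E : Type*} [NormedAddCommGroup E] [NormedSpace ℝ E]

lemma det_exp_zero_smul (A : E →L[ℝ] E) : (NormedSpace.exp ((0 : ℝ) • A)).det = 1 := by
  rw [zero_smul, NormedSpace.exp_zero, ContinuousLinearMap.det,
    ContinuousLinearMap.toLinearMap_one, Module.End.one_eq_id, LinearMap.det_id]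

variable [FiniteDimensional ℝ E]

lemma differentiable_det : Differentiable ℝ fun L : E →L[ℝ] E => L.det := by
  let b := Module.finBasis ℝ E
  have hentry : ∀ i j, Differentiable ℝ fun L : E →L[ℝ] E =>
      LinearMap.toMatrix b b (L : E →ₗ[ℝ] E) i j := fun i j => by
    simp only [LinearMap.toMatrix_apply, ContinuousLinearMap.coe_coe]
    exact (LinearMap.toContinuousLinearMap (b.coord i)).differentiable.comp
      (ContinuousLinearMap.apply ℝ E (b j)).differentiable
  simp only [ContinuousLinearMap.det, ← LinearMap.det_toMatrix b, Matrix.det_apply]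
  fun_prop

lemma hasDerivAt_det_one_add_smul (A : E →L[ℝ] E) :
    HasDerivAt (fun c : ℝ => (1 + c • A).det) (LinearMap.trace ℝ E A) 0 := by
  let b := Module.finBasis ℝ E
  let M := LinearMap.toMatrix b b (A : E →ₗ[ℝ] E)
  let R := (Matrix.det (1 + (Polynomial.X : Polynomial ℝ) • M.map Polynomial.C)).divX.divX
  have hexpand : (fun c : ℝ => (1 + c • A).det) =
      fun c => 1 + LinearMap.trace ℝ E A * c + R.eval c * c ^ 2 := by
    ext c
    rw [LinearMap.trace_eq_matrix_trace ℝ b, ← Matrix.det_one_add_smul, ← LinearMap.toMatrix_one b,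
      ← map_smul, ← map_add, LinearMap.det_toMatrix]
    rfl
  rw [hexpand]
  simpa using (((hasDerivAt_id (0 : ℝ)).const_mul (LinearMap.trace ℝ E A)).const_add 1).fun_add
    ((R.hasDerivAt 0).fun_mul (hasDerivAt_pow 2 (0 : ℝ)))

lemma continuous_exp_smul (A : E →L[ℝ] E) : Continuous fun c : ℝ => NormedSpace.exp (c • A) := by
  have : CompleteSpace E := FiniteDimensional.complete ℝ E
  exact continuous_iff_continuousAt.2 fun c => (hasDerivAt_exp_smul_const A c).continuousAt

lemma exp_add_smul (A : E →L[ℝ] E) (a b : ℝ) :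
    NormedSpace.exp ((a + b) • A) = NormedSpace.exp (a • A) * NormedSpace.exp (b • A) := by
  have : CompleteSpace E := FiniteDimensional.complete ℝ E
  let _ : NormedAlgebra ℚ (E →L[ℝ] E) := NormedAlgebra.restrictScalars ℚ ℝ _
  rw [add_smul, NormedSpace.exp_add_of_commute (((Commute.refl A).smul_left a).smul_right b)]

lemma hasDerivAt_det_exp_smul (A : E →L[ℝ] E) :
    HasDerivAt (fun c : ℝ => (NormedSpace.exp (c • A)).det) (LinearMap.trace ℝ E A) 0 := by
  have : CompleteSpace E := FiniteDimensional.complete ℝ E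
  have hdet := (differentiable_det (1 : E →L[ℝ] E)).hasFDerivAt
  have hlinear : HasDerivAt (fun c : ℝ => 1 + c • A) A 0 := by
    simpa using ((hasDerivAt_id (0 : ℝ)).smul_const A).const_add 1
  have hexp : HasDerivAt (fun c : ℝ => NormedSpace.exp (c • A)) A 0 := by
    simpa using hasDerivAt_exp_smul_const A (0 : ℝ)
  rw [(hasDerivAt_det_one_add_smul A).unique
    (hdet.comp_hasDerivAt_of_eq (0 : ℝ) hlinear (by simp))]
  exact hdet.comp_hasDerivAt_of_eq (0 : ℝ) hexp (by simp)

lemma hasDerivAt_abs_det_exp_smul (A : E →L[ℝ] E) :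
    HasDerivAt (fun c : ℝ => |(NormedSpace.exp (c • A)).det|) (LinearMap.trace ℝ E A) 0 := by
  have hdet := hasDerivAt_det_exp_smul A
  refine hdet.congr_of_eventuallyEq ?_
  filter_upwards [hdet.continuousAt.eventually_const_lt (det_exp_zero_smul A ▸ one_pos)] with c hc
    using abs_of_pos hc

end OperatorExponential

section ConvexBodies

open scoped Pointwise

variable {V : Type*} [NormedAddCommGroup V] [NormedSpace ℝ V]

lemma mem_add_smul_iff {K L : ConvexBody V} {h : ℝ} {z : V} :
    z ∈ K + h • L ↔ ∃ x ∈ K, ∃ y ∈ L, x + h • y = z := by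
  simp only [← SetLike.mem_coe, ConvexBody.coe_add, ConvexBody.coe_smul, Set.mem_add,
    Set.mem_smul_set, exists_exists_and_eq_and]

lemma add_smul_of_nonneg (K : ConvexBody V) {a b : ℝ} (ha : 0 ≤ a) (hb : 0 ≤ b) :
    (a + b) • K = a • K + b • K :=
  add_smul (R := NNReal) ⟨a, ha⟩ ⟨b, hb⟩ K

lemma zero_smul_convexBody (K : ConvexBody V) : (0 : ℝ) • K = 0 :=
  zero_smul NNReal K

instance : IsOrderedAddMonoid (ConvexBody V) where
  add_le_add_left _ _ h _ := Set.add_subset_add_right h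

lemma exists_mem_dist_le (L : ConvexBody V) {K : ConvexBody V} {x : V} (hx : x ∈ K) :
    ∃ y ∈ L, dist x y ≤ dist K L := by
  obtain ⟨y, hy, hxy⟩ := L.isCompact.exists_infDist_eq_dist L.nonempty x
  exact ⟨y, hy, hxy ▸ Metric.infDist_le_hausdorffDist_of_mem hx ConvexBody.hausdorffEDist_ne_top⟩

lemma dist_add_add_le_convexBody (K K' L L' : ConvexBody V) :
    dist (K + L) (K' + L') ≤ dist K K' + dist L L' := by
  have hmem : ∀ K K' L L' : ConvexBody V, ∀ z ∈ (K + L : Set V), ∃ w ∈ (K' + L' : Set V),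
      dist z w ≤ dist K K' + dist L L' := by
    rintro K K' L L' _ ⟨x, hx, y, hy, rfl⟩
    obtain ⟨x', hx', hxx'⟩ := exists_mem_dist_le K' hx
    obtain ⟨y', hy', hyy'⟩ := exists_mem_dist_le L' hy
    exact ⟨x' + y', add_mem_add hx' hy', (dist_add_add_le _ _ _ _).trans (add_le_add hxx' hyy')⟩
  rw [← ConvexBody.hausdorffDist_coe, ConvexBody.coe_add, ConvexBody.coe_add]
  refine Metric.hausdorffDist_le_of_mem_dist (by positivity) (hmem K K' L L') ?_
  simpa only [dist_comm] using hmem K' K L' L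

instance : ContinuousAdd (ConvexBody V) where
  continuous_add := by
    refine continuous_iff_continuousAt.2 fun q => tendsto_iff_dist_tendsto_zero.2 ?_
    refine squeeze_zero (fun _ => dist_nonneg)
      (fun x => dist_add_add_le_convexBody x.1 q.1 x.2 q.2) ?_
    have hcont : Continuous fun x : ConvexBody V × ConvexBody V =>
      dist x.1 q.1 + dist x.2 q.2 := by fun_prop
    simpa using hcont.tendsto q

lemma tendsto_smul_zero (K : ConvexBody V) : Tendsto (fun h : ℝ => h • K) (𝓝 0) (𝓝 0) := by
  obtain ⟨R, hR0, hR⟩ := K.isBounded.exists_pos_norm_le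
  have hdist : ∀ h : ℝ, dist (h • K) 0 ≤ |h| * R := fun h => by
    have hnorm : ∀ x ∈ K, ‖h • x‖ ≤ |h| * R := fun x hx => by
      rw [norm_smul, Real.norm_eq_abs]
      exact mul_le_mul_of_nonneg_left (hR x hx) (abs_nonneg h)
    rw [← ConvexBody.hausdorffDist_coe, ConvexBody.coe_smul, ConvexBody.coe_zero]
    refine Metric.hausdorffDist_le_of_mem_dist (by positivity) ?_ ?_
    · rintro _ ⟨x, hx, rfl⟩
      exact ⟨0, rfl, (dist_zero_right (h • x)).trans_le (hnorm x hx)⟩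
    · rintro _ rfl
      obtain ⟨x, hx⟩ := K.nonempty
      exact ⟨h • x, smul_mem_smul_set hx, (dist_zero_left (h • x)).trans_le (hnorm x hx)⟩
  have hlim : Tendsto (fun h : ℝ => |h| * R) (𝓝 0) (𝓝 0) := by
    have hcont : Continuous fun h : ℝ => |h| * R := by fun_prop
    simpa using hcont.tendsto 0
  exact tendsto_iff_dist_tendsto_zero.2 (squeeze_zero (fun _ => dist_nonneg) hdist hlim)

lemma tendsto_add_smul (K L : ConvexBody V) :
    Tendsto (fun h : ℝ => K + h • L) (𝓝 0) (𝓝 K) := by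
  simpa using (tendsto_const_nhds (x := K)).add (tendsto_smul_zero L)

/-- The closed unit ball as a convex body; adding `r` times this body to `K` gives the closed
`r`-neighbourhood of `K`. -/
def unitBall (V : Type*) [NormedAddCommGroup V] [NormedSpace ℝ V] [ProperSpace V] :
    ConvexBody V where
  carrier := Metric.closedBall 0 1
  convex' := convex_closedBall 0 1
  isCompact' := isCompact_closedBall 0 1
  nonempty' := ⟨0, Metric.mem_closedBall_self zero_le_one⟩

lemma mem_unitBall [ProperSpace V] {x : V} : x ∈ unitBall V ↔ ‖x‖ ≤ 1 :=
  mem_closedBall_zero_iff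

lemma le_add_smul_unitBall [ProperSpace V] {K L : ConvexBody V} {r : ℝ} (h : dist K L ≤ r) :
    K ≤ L + r • unitBall V := by
  intro x hx
  obtain ⟨y, hy, hxy⟩ := exists_mem_dist_le L hx
  have hr : 0 ≤ r := dist_nonneg.trans h
  have hball : x - y ∈ r • Metric.closedBall (0 : V) 1 := by
    rw [smul_unitClosedBall_of_nonneg hr, mem_closedBall_zero_iff, ← dist_eq_norm]
    exact hxy.trans h
  obtain ⟨b, hb, hbxy⟩ := hball
  exact mem_add_smul_iff.2 ⟨y, hy, b, hb, by simp only [hbxy, add_sub_cancel]⟩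

end ConvexBodies

section Volume

open scoped Pointwise

lemma measureReal_mono_convexBody {V : Type*} [TopologicalSpace V] [AddCommGroup V] [Module ℝ V]
    [MeasurableSpace V] (μ : Measure V) [IsFiniteMeasureOnCompacts μ] {K L : ConvexBody V}
    (h : K ≤ L) : μ.real K ≤ μ.real L :=
  measureReal_mono h L.isCompact.measure_lt_top.ne

lemma measureReal_le_measureReal_cthickening {V : Type*} [NormedAddCommGroup V] [NormedSpace ℝ V]
    [ProperSpace V] [MeasurableSpace V] (μ : Measure V) [IsFiniteMeasureOnCompacts μ]
    (K L : ConvexBody V) :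
    μ.real L ≤ μ.real (Metric.cthickening (dist L K) (K : Set V)) := by
  refine measureReal_mono (fun x hx => ?_) K.isCompact.cthickening.measure_lt_top.ne
  obtain ⟨y, hy, hxy⟩ := exists_mem_dist_le K hx
  exact Metric.mem_cthickening_of_dist_le x y _ _ hy hxy

variable {E : Type*} [NormedAddCommGroup E] [NormedSpace ℝ E]
  [MeasurableSpace E] [BorelSpace E] (μ : Measure E) [μ.IsAddHaarMeasure]

lemma measureReal_le_measureReal_add (K L : ConvexBody E) : μ.real K ≤ μ.real (K + L : Set E) := by
  obtain ⟨y, hy⟩ := L.nonempty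
  calc μ.real K = μ.real ((fun x => x + y) '' (K : Set E)) := by
        rw [image_add_right, measureReal_def, measureReal_def, measure_preimage_add_right]
    _ ≤ μ.real (K + L : Set E) := by
        refine measureReal_mono ?_ (K.isCompact.add L.isCompact).measure_lt_top.ne
        rintro _ ⟨x, hx, rfl⟩
        exact add_mem_add hx hy

variable [FiniteDimensional ℝ E]

lemma tendsto_measureReal_cthickening_dist (K : ConvexBody E) :
    Tendsto (fun L : ConvexBody E => μ.real (Metric.cthickening (dist L K) (K : Set E))) (𝓝 K)
      (𝓝 (μ.real K)) :=
  (ENNReal.tendsto_toReal K.isCompact.measure_lt_top.ne).comp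
    ((tendsto_measure_cthickening_of_isCompact K.isCompact).comp
      (tendsto_iff_dist_tendsto_zero.1 tendsto_id))

lemma tendsto_measureReal_add_smul (K L : ConvexBody E) :
    Tendsto (fun h : ℝ => μ.real (K + h • L : ConvexBody E)) (𝓝 0) (𝓝 (μ.real K)) :=
  tendsto_of_tendsto_of_tendsto_of_le_of_le tendsto_const_nhds
    ((tendsto_measureReal_cthickening_dist μ K).comp (tendsto_add_smul K L))
    (fun h => measureReal_le_measureReal_add μ K (h • L))
    (fun h => measureReal_le_measureReal_cthickening μ K (K + h • L))

end Volume

section VolumeContinuity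

open Polynomial

variable {E : Type*} [NormedAddCommGroup E] [InnerProductSpace ℝ E] [FiniteDimensional ℝ E]
  [MeasurableSpace E] [BorelSpace E] (μ : Measure E) [μ.IsAddHaarMeasure]

theorem exists_polynomial_measureReal_convexBody (K L : ConvexBody E) :
    ∃ P : ℝ[X], P.natDegree ≤ Module.finrank ℝ E ∧
      ∀ h ≥ 0, P.eval h = μ.real (K + h • L : ConvexBody E) := by
  obtain ⟨P, hdeg, hP⟩ := exists_polynomial_measureReal_add_smul μ K.isCompact K.nonempty K.convex
    L.isCompact L.nonempty L.convex
  refine ⟨P, hdeg, fun h hh => hh.eq_or_lt.elim ?_ (hP h)⟩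
  rintro rfl
  have hzero : P.eval 0 = μ.real K :=
    tendsto_nhds_unique ((P.continuous.tendsto 0).mono_left nhdsWithin_le_nhds)
      (((tendsto_measureReal_add_smul μ K L).mono_left nhdsWithin_le_nhds).congr'
        (eventually_mem_nhdsWithin.mono fun h (hh : h ∈ Ioi 0) => (hP h hh).symm))
  rw [hzero, zero_smul_convexBody, add_zero]

lemma exists_forall_natDegree_le_eval_sub_le (d : ℕ) (C : ℝ) :
    ∃ ω : ℝ → ℝ, Tendsto ω (𝓝 0) (𝓝 0) ∧ ∀ P : ℝ[X], P.natDegree ≤ d →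
      (∀ i ∈ Finset.range (d + 1), |P.eval ((i : ℝ) + 1)| ≤ C) →
        ∀ h, P.eval h - P.eval 0 ≤ ω h := by
  refine ⟨fun h => ∑ i ∈ Finset.range (d + 1),
    C * |(lagrangeWeight d i).eval h - (lagrangeWeight d i).eval 0|, ?_, fun P hd hC h => ?_⟩
  · have hcont : Continuous fun h => ∑ i ∈ Finset.range (d + 1),
        C * |(lagrangeWeight d i).eval h - (lagrangeWeight d i).eval 0| := by fun_prop
    simpa using hcont.tendsto 0
  · rw [eval_eq_sum_lagrangeWeight hd h, eval_eq_sum_lagrangeWeight hd 0, ← Finset.sum_sub_distrib]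
    refine Finset.sum_le_sum fun i hi => ?_
    rw [← mul_sub]
    exact (le_abs_self _).trans ((abs_mul _ _).trans_le
      (mul_le_mul_of_nonneg_right (hC i hi) (abs_nonneg _)))

/-- Lower semicontinuity rests on Minkowski's polynomial: `μ (L + r • B) - μ L` is small with `r`,
uniformly over the bodies `L` near `K`. -/
theorem continuous_measureReal : Continuous fun K : ConvexBody E => μ.real K := by
  refine continuous_iff_continuousAt.2 fun K => ?_
  set B := unitBall E
  set d := Module.finrank ℝ E
  obtain ⟨ω, hω, hωP⟩ := exists_forall_natDegree_le_eval_sub_le d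
    (μ.real (K + ((d : ℝ) + 2) • B : ConvexBody E))
  have hbound : ∀ L : ConvexBody E, dist L K ≤ 1 → ∀ i ∈ Finset.range (d + 1),
      L + ((i : ℝ) + 1) • B ≤ K + ((d : ℝ) + 2) • B := fun L hL i hi => by
    have hi : (i : ℝ) ≤ d := by exact_mod_cast Nat.lt_succ_iff.1 (Finset.mem_range.1 hi)
    calc L + ((i : ℝ) + 1) • B
        ≤ K + ((d : ℝ) + 1 - i) • B + ((i : ℝ) + 1) • B := by
          gcongr
          exact le_add_smul_unitBall (by linarith)
      _ = K + ((d : ℝ) + 2) • B := by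
          rw [add_assoc, ← add_smul_of_nonneg B (by linarith) (by positivity)]
          ring_nf
  have hlower : ∀ L : ConvexBody E, dist L K ≤ 1 → μ.real K - ω (dist L K) ≤ μ.real L := by
    intro L hL
    obtain ⟨P, hPd, hP⟩ := exists_polynomial_measureReal_convexBody μ L B
    have hosc := hωP P hPd (fun i hi => by
      rw [hP _ (by positivity), abs_of_nonneg measureReal_nonneg]
      exact measureReal_mono_convexBody μ (hbound L hL i hi)) (dist L K)
    rw [hP _ dist_nonneg, hP 0 le_rfl, zero_smul_convexBody, add_zero] at hosc
    linarith [measureReal_mono_convexBody μ (le_add_smul_unitBall (dist_comm K L).le)]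
  have hdist : Tendsto (fun L : ConvexBody E => dist L K) (𝓝 K) (𝓝 0) :=
    tendsto_iff_dist_tendsto_zero.1 tendsto_id
  refine tendsto_of_tendsto_of_tendsto_of_le_of_le' ?_
    (tendsto_measureReal_cthickening_dist μ K)
    (mem_of_superset (Metric.closedBall_mem_nhds K one_pos) hlower)
    (Eventually.of_forall (measureReal_le_measureReal_cthickening μ K))
  simpa using tendsto_const_nhds.sub (hω.comp hdist)

end VolumeContinuity

section SupportFunction

variable {n : ℕ} {K L : Conv n}

lemma bddAbove_image_inner (K : Conv n) (p : EuclideanSpace ℝ (Fin n)) :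
    BddAbove ((fun x : EuclideanSpace ℝ (Fin n) => inner ℝ x p) '' K) :=
  (K.isCompact.image (by fun_prop)).bddAbove

lemma inner_le_supp {x : EuclideanSpace ℝ (Fin n)} (hx : x ∈ K) (p : EuclideanSpace ℝ (Fin n)) :
    inner ℝ x p ≤ supp K p :=
  le_csSup (bddAbove_image_inner K p) (mem_image_of_mem _ hx)

lemma supp_le {p : EuclideanSpace ℝ (Fin n)} {r : ℝ} (h : ∀ x ∈ K, inner ℝ x p ≤ r) :
    supp K p ≤ r :=
  csSup_le (K.nonempty.image _) (forall_mem_image.2 h)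

lemma exists_inner_eq_supp (K : Conv n) (p : EuclideanSpace ℝ (Fin n)) :
    ∃ x ∈ K, inner ℝ x p = supp K p :=
  (K.isCompact.image (f := fun x : EuclideanSpace ℝ (Fin n) => inner ℝ x p)
    (by fun_prop)).sSup_mem (K.nonempty.image _)

lemma supp_mono (h : K ≤ L) (p : EuclideanSpace ℝ (Fin n)) : supp K p ≤ supp L p :=
  supp_le fun _ hx => inner_le_supp (h hx) p

lemma le_of_forall_supp_le (h : ∀ p, supp K p ≤ supp L p) : K ≤ L := by
  intro x hx
  by_contra hxL
  obtain ⟨f, s, hLs, hsx⟩ := geometric_hahn_banach_closed_point L.convex L.isClosed hxL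
  set p := (InnerProductSpace.toDual ℝ (EuclideanSpace ℝ (Fin n))).symm f
  have hf : ∀ y, inner ℝ y p = f y := fun y => by
    rw [real_inner_comm, InnerProductSpace.toDual_symm_apply]
  have hLp : supp L p ≤ s := supp_le fun y hy => (hf y).trans_le (hLs y hy).le
  have hxp : f x ≤ supp K p := (hf x).symm.trans_le (inner_le_supp hx p)
  linarith [h p]

lemma supp_add_smul (K L : Conv n) {h : ℝ} (hh : 0 ≤ h) (p : EuclideanSpace ℝ (Fin n)) :
    supp (K + h • L) p = supp K p + h * supp L p := by
  have hinner : ∀ x y : EuclideanSpace ℝ (Fin n),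
      inner ℝ (x + h • y) p = inner ℝ x p + h * inner ℝ y p := fun x y => by
    rw [inner_add_left, real_inner_smul_left]
  apply le_antisymm
  · refine supp_le fun z hz => ?_
    obtain ⟨x, hx, y, hy, rfl⟩ := mem_add_smul_iff.1 hz
    rw [hinner]
    exact add_le_add (inner_le_supp hx p) (mul_le_mul_of_nonneg_left (inner_le_supp hy p) hh)
  · obtain ⟨x, hx, hxp⟩ := exists_inner_eq_supp K p
    obtain ⟨y, hy, hyp⟩ := exists_inner_eq_supp L p
    rw [← hxp, ← hyp, ← hinner]
    exact inner_le_supp (mem_add_smul_iff.2 ⟨x, hx, y, hy, rfl⟩) p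

lemma supp_sub_supp_le (K L : Conv n) (p : EuclideanSpace ℝ (Fin n)) :
    supp K p - supp L p ≤ ‖p‖ * dist K L := by
  have hball : supp (unitBall (EuclideanSpace ℝ (Fin n))) p ≤ ‖p‖ := supp_le fun x hx =>
    (real_inner_le_norm x p).trans (mul_le_of_le_one_left (norm_nonneg p) (mem_unitBall.1 hx))
  have hmono := supp_mono (le_add_smul_unitBall (le_refl (dist K L))) p
  rw [supp_add_smul _ _ dist_nonneg] at hmono
  linarith [mul_le_mul_of_nonneg_left hball (dist_nonneg (x := K) (y := L))]

lemma continuous_supp (p : EuclideanSpace ℝ (Fin n)) : Continuous fun K : Conv n => supp K p := by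
  refine (LipschitzWith.of_dist_le_mul (K := ‖p‖₊) fun K L => abs_sub_le_iff.2 ?_).continuous
  exact ⟨supp_sub_supp_le K L p, dist_comm K L ▸ supp_sub_supp_le L K p⟩

end SupportFunction

section LinearImage

variable {n : ℕ}

lemma coe_linImage (T : EuclideanSpace ℝ (Fin n) →L[ℝ] EuclideanSpace ℝ (Fin n)) (K : Conv n) :
    (linImage T K : Set (EuclideanSpace ℝ (Fin n))) = T '' K :=
  rfl

lemma linImage_linImage (S T : EuclideanSpace ℝ (Fin n) →L[ℝ] EuclideanSpace ℝ (Fin n))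
    (K : Conv n) : linImage S (linImage T K) = linImage (S * T) K :=
  SetLike.ext' (image_image S T K)

lemma linImage_add_smul (T : EuclideanSpace ℝ (Fin n) →L[ℝ] EuclideanSpace ℝ (Fin n))
    (K L : Conv n) (h : ℝ) : linImage T (K + h • L) = linImage T K + h • linImage T L :=
  SetLike.ext' <| by
    simp only [coe_linImage, ConvexBody.coe_add, ConvexBody.coe_smul, Set.image_add,
      image_smul_set]

lemma vol_linImage (T : EuclideanSpace ℝ (Fin n) →L[ℝ] EuclideanSpace ℝ (Fin n)) (K : Conv n) :
    vol (linImage T K) = |T.det| * vol K := by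
  rw [vol, coe_linImage, Measure.addHaar_image_continuousLinearMap, ENNReal.toReal_mul,
    ENNReal.toReal_ofReal (abs_nonneg _), vol]

lemma dist_apply_le {E F : Type*} [NormedAddCommGroup E] [NormedSpace ℝ E] [NormedAddCommGroup F]
    [NormedSpace ℝ F] (S T : E →L[ℝ] F) (x y : E) :
    dist (S x) (T y) ≤ ‖S‖ * dist x y + ‖S - T‖ * ‖y‖ := by
  calc dist (S x) (T y) ≤ dist (S x) (S y) + dist (S y) (T y) := dist_triangle _ _ _
    _ ≤ ‖S‖ * dist x y + ‖S - T‖ * ‖y‖ := by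
      rw [dist_eq_norm (S y), ← sub_apply]
      exact add_le_add (S.lipschitz.dist_le_mul x y) ((S - T).le_opNorm y)

lemma dist_linImage_le (S T : EuclideanSpace ℝ (Fin n) →L[ℝ] EuclideanSpace ℝ (Fin n))
    (K : Conv n) {L : Conv n} {R : ℝ} (hL : ∀ y ∈ L, ‖y‖ ≤ R) :
    dist (linImage S K) (linImage T L) ≤ ‖S‖ * dist K L + ‖S - T‖ * R := by
  have hbound : ∀ x, ∀ y ∈ L, dist x y ≤ dist K L →
      dist (S x) (T y) ≤ ‖S‖ * dist K L + ‖S - T‖ * R := fun x y hy hxy =>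
    (dist_apply_le S T x y).trans (by gcongr; exact hL y hy)
  obtain ⟨y₀, hy₀⟩ := L.nonempty
  have hR : 0 ≤ R := (norm_nonneg y₀).trans (hL y₀ hy₀)
  rw [← ConvexBody.hausdorffDist_coe]
  refine Metric.hausdorffDist_le_of_mem_dist (by positivity) ?_ ?_
  · rintro _ ⟨x, hx, rfl⟩
    obtain ⟨y, hy, hxy⟩ := exists_mem_dist_le L hx
    exact ⟨T y, ⟨y, hy, rfl⟩, hbound x y hy hxy⟩
  · rintro _ ⟨y, hy, rfl⟩
    obtain ⟨x, hx, hxy⟩ := exists_mem_dist_le K hy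
    rw [dist_comm, dist_comm L] at hxy
    exact ⟨S x, ⟨x, hx, rfl⟩, (dist_comm _ _).trans_le (hbound x y hy hxy)⟩

lemma continuous_linImage : Continuous fun q : (EuclideanSpace ℝ (Fin n) →L[ℝ]
    EuclideanSpace ℝ (Fin n)) × Conv n => linImage q.1 q.2 := by
  refine continuous_iff_continuousAt.2 fun q => tendsto_iff_dist_tendsto_zero.2 ?_
  obtain ⟨R, -, hR⟩ := q.2.isBounded.exists_pos_norm_le
  refine squeeze_zero (fun _ => dist_nonneg) (fun x => dist_linImage_le x.1 q.1 x.2 hR) ?_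
  have hcont : Continuous fun x : (EuclideanSpace ℝ (Fin n) →L[ℝ] EuclideanSpace ℝ (Fin n)) ×
      Conv n => ‖x.1‖ * dist x.2 q.2 + ‖x.1 - q.1‖ * R := by fun_prop
  simpa using hcont.tendsto q

variable (A : EuclideanSpace ℝ (Fin n) →L[ℝ] EuclideanSpace ℝ (Fin n))

lemma continuous_expFlow : Continuous fun q : ℝ × Conv n => expFlow A q.1 q.2 :=
  continuous_linImage.comp (((continuous_exp_smul A).comp continuous_fst).prodMk continuous_snd)

lemma expFlow_zero (K : Conv n) : expFlow A 0 K = K := by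
  have hexp : NormedSpace.exp ((0 : ℝ) • A) = 1 :=
    (congrArg NormedSpace.exp (zero_smul ℝ A)).trans NormedSpace.exp_zero
  exact (congrArg (linImage · K) hexp).trans (SetLike.ext' (image_id _))

lemma expFlow_expFlow (a b : ℝ) (K : Conv n) :
    expFlow A a (expFlow A b K) = expFlow A (a + b) K :=
  (linImage_linImage _ _ K).trans (congrArg (linImage · K) (exp_add_smul A a b).symm)

end LinearImage

section MixedVolume

open Polynomial

variable {n : ℕ}

lemma vol_nonneg (K : Conv n) : 0 ≤ vol K := ENNReal.toReal_nonneg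

lemma vol_mono {K L : Conv n} (h : K ≤ L) : vol K ≤ vol L := measureReal_mono_convexBody volume h

lemma continuous_vol : Continuous (vol : Conv n → ℝ) := continuous_measureReal volume

lemma vol_smul (K : Conv n) {c : ℝ} (hc : 0 ≤ c) : vol (c • K) = c ^ n * vol K := by
  rw [vol, ConvexBody.coe_smul, Measure.addHaar_smul, ENNReal.toReal_mul,
    finrank_euclideanSpace_fin, abs_of_nonneg (by positivity),
    ENNReal.toReal_ofReal (by positivity), vol]

lemma exists_polynomial_vol_add_smul (u w : Conv n) :
    ∃ P : ℝ[X], P.natDegree ≤ n ∧ ∀ h ≥ 0, P.eval h = vol (u + h • w) := by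
  simpa using! exists_polynomial_measureReal_convexBody volume u w

lemma continuous_mixedVol (m : ℕ) (u : Conv n) : Continuous (mixedVol m u) := by
  refine continuous_const.mul (continuous_finsetSum _ fun S _ => continuous_const.mul
    (continuous_vol.comp (continuous_finsetSum _ fun i _ => ?_)))
  dsimp only
  split_ifs
  exacts [continuous_const, continuous_id]

lemma eq_reflect_of_eval_eq_vol {u w : Conv n} {P Q : ℝ[X]} (hPdeg : P.natDegree ≤ n)
    (hP : ∀ h ≥ 0, P.eval h = vol (u + h • w)) (hQ : ∀ m ≥ 0, Q.eval m = vol (w + m • u)) :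
    Q = P.reflect n := by
  have heq : ∀ m : ℝ, 0 < m → Q.eval m = (P.reflect n).eval m := fun m hm => by
    have : Invertible m⁻¹ := invertibleOfNonzero (inv_ne_zero hm.ne')
    have hreflect := eval₂_reflect_mul_pow (RingHom.id ℝ) m⁻¹ n P hPdeg
    rw [eval₂_id, eval₂_id, invOf_eq_inv, inv_inv, hP _ (inv_nonneg.2 hm.le)] at hreflect
    calc Q.eval m = vol (m • (u + m⁻¹ • w)) := by
          rw [hQ m hm.le, smul_add, smul_smul, mul_inv_cancel₀ hm.ne', one_smul, add_comm]
      _ = m ^ n * vol (u + m⁻¹ • w) := vol_smul _ hm.le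
      _ = (P.reflect n).eval m := by
          rw [← hreflect, inv_pow, mul_comm, inv_mul_cancel_right₀ (pow_ne_zero n hm.ne')]
  exact eq_of_infinite_eval_eq _ _ ((Ioi_infinite 0).mono heq)

lemma fwdDiff_iter_eval_eq_factorial_mul_coeff {R : Type*} [CommRing R] {N : ℕ} {P : R[X]}
    (hP : P.natDegree ≤ N) (y : R) :
    (fwdDiff 1)^[N] P.eval y = N.factorial * P.coeff N := by
  rcases hP.eq_or_lt with rfl | hlt
  · rw [fwdDiff_iter_degree_eq_factorial, Pi.smul_apply, smul_eq_mul, mul_comm]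
    rfl
  · rw [fwdDiff_iter_eq_zero_of_degree_lt hlt, coeff_eq_zero_of_natDegree_lt hlt, mul_zero]
    rfl

/-- The `N`-th difference of `m ↦ V[m u + w] - V[m u]`, a polynomial of degree at most `N` whose
leading coefficient is the linear coefficient of `h ↦ V[u + h w]`. -/
lemma sum_choose_mul_vol_sub {N : ℕ} {u w : Conv (N + 1)} {P : ℝ[X]}
    (hdeg : P.natDegree ≤ N + 1) (hP : ∀ h ≥ 0, P.eval h = vol (u + h • w)) :
    ∑ m ∈ Finset.range (N + 1), (-1 : ℝ) ^ (N - m) * N.choose m *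
      (vol (w + (m : ℝ) • u) - vol ((m : ℝ) • u)) = N.factorial * P.coeff 1 := by
  obtain ⟨Q, hQdeg, hQ⟩ := exists_polynomial_vol_add_smul w u
  have hQP : Q = P.reflect (N + 1) := eq_reflect_of_eval_eq_vol hdeg hP hQ
  have htop : Q.coeff (N + 1) = vol u := by
    have hzero := hP 0 le_rfl
    rw [zero_smul_convexBody, add_zero, ← coeff_zero_eq_eval_zero] at hzero
    rw [hQP, coeff_reflect, revAt_le le_rfl, Nat.sub_self, hzero]
  have hnext : Q.coeff N = P.coeff 1 := by
    rw [hQP, coeff_reflect, revAt_le N.le_succ, Nat.succ_eq_add_one, Nat.add_sub_cancel_left]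
  set R : ℝ[X] := Q - C (vol u) * X ^ (N + 1) with hR
  have hRdeg : R.natDegree ≤ N := by
    refine natDegree_le_iff_coeff_eq_zero.2 fun j hj => ?_
    rw [hR, coeff_sub, coeff_C_mul_X_pow]
    split_ifs with hjN
    · rw [hjN, htop, sub_self]
    · rw [coeff_eq_zero_of_natDegree_lt (hQdeg.trans_lt (by omega)), sub_zero]
  have hRcoeff : R.coeff N = P.coeff 1 := by
    rw [hR, coeff_sub, coeff_C_mul_X_pow, if_neg N.succ_ne_self.symm, hnext, sub_zero]
  rw [← hRcoeff, ← fwdDiff_iter_eval_eq_factorial_mul_coeff hRdeg 0, fwdDiff_iter_eq_sum_shift]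
  refine Finset.sum_congr rfl fun m _ => ?_
  have hm : (0 : ℝ) ≤ m := m.cast_nonneg
  have heval : R.eval (m : ℝ) = vol (w + (m : ℝ) • u) - vol ((m : ℝ) • u) := by
    rw [hR, eval_sub, hQ _ hm, vol_smul u hm, eval_C_mul, eval_X_pow, mul_comm]
  rw [zero_add, nsmul_one, heval, zsmul_eq_mul]
  push_cast
  rfl

lemma sum_finset_fin_succ {M : Type*} [AddCommMonoid M] {N : ℕ} (f : Finset (Fin (N + 1)) → M) :
    ∑ S, f S = ∑ S : Finset (Fin N), (f (S.map Fin.castSuccEmb) +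
      f (insert (Fin.last N) (S.map Fin.castSuccEmb))) := by
  have hlast : Fin.last N ∉ Finset.univ.map Fin.castSuccEmb := by simp [Fin.castSucc_ne_last]
  have hmap : ((Finset.univ : Finset (Fin N)).map Fin.castSuccEmb).powerset =
      (Finset.univ : Finset (Finset (Fin N))).map
        (Finset.mapEmbedding Fin.castSuccEmb).toEmbedding := by
    rw [Finset.map_eq_image, Finset.map_eq_image, Finset.powerset_image, Finset.powerset_univ]
    exact Finset.image_congr fun S _ => (Finset.map_eq_image _ S).symm
  rw [← Finset.powerset_univ, Fin.univ_castSuccEmb, Finset.cons_eq_insert,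
    Finset.sum_powerset_insert hlast, ← Finset.sum_add_distrib, hmap, Finset.sum_map]
  rfl

lemma sum_finset_apply_card {R : Type*} [CommRing R] (N : ℕ) (f : ℕ → R) :
    ∑ S : Finset (Fin N), f S.card = ∑ m ∈ Finset.range (N + 1), N.choose m * f m := by
  rw [← Finset.powerset_univ, Finset.sum_powerset_apply_card, Finset.card_fin]
  simp only [nsmul_eq_mul]

lemma factorial_mul_mixedVol_one {N : ℕ} (u w : Conv (N + 1)) :
    (N + 1).factorial * mixedVol 1 u w = ∑ m ∈ Finset.range (N + 1), (-1 : ℝ) ^ (N - m) *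
      N.choose m * (vol (w + (m : ℝ) • u) - vol ((m : ℝ) • u)) := by
  have hsum : ∀ S : Finset (Fin N), (∑ i ∈ S.map Fin.castSuccEmb,
      if (i : ℕ) + 1 < N + 1 then u else w) = (S.card : ℝ) • u := fun S => by
    simpa using! (Nat.cast_smul_eq_nsmul NNReal S.card u).symm
  have hlast : ∀ S : Finset (Fin N), Fin.last N ∉ S.map Fin.castSuccEmb := fun S => by
    simp [Fin.castSucc_ne_last]
  have hsum_insert : ∀ S : Finset (Fin N), (∑ i ∈ insert (Fin.last N) (S.map Fin.castSuccEmb),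
      if (i : ℕ) + 1 < N + 1 then u else w) = w + (S.card : ℝ) • u := fun S => by
    rw [Finset.sum_insert (hlast S), hsum, Fin.val_last, if_neg (lt_irrefl _)]
  rw [mixedVol, mixedVolume, mul_inv_cancel_left₀ (by positivity), sum_finset_fin_succ]
  simp only [hsum, hsum_insert, Finset.card_map, Finset.card_insert_of_notMem (hlast _)]
  rw [sum_finset_apply_card N fun m => (-1 : ℝ) ^ (N + 1 - m) * vol ((m : ℝ) • u) +
    (-1) ^ (N + 1 - (m + 1)) * vol (w + (m : ℝ) • u)]
  refine Finset.sum_congr rfl fun m hm => ?_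
  rw [Nat.succ_sub (Nat.lt_succ_iff.1 (Finset.mem_range.1 hm)), Nat.succ_sub_succ, pow_succ]
  ring

theorem hasDerivWithinAt_vol_add_smul (hn : 1 ≤ n) (u w : Conv n) :
    HasDerivWithinAt (fun h : ℝ => vol (u + h • w)) (n * mixedVol 1 u w) (Ici 0) 0 := by
  obtain ⟨N, rfl⟩ := Nat.exists_eq_add_of_le' hn
  obtain ⟨P, hdeg, hP⟩ := exists_polynomial_vol_add_smul u w
  have hderiv : ((N + 1 : ℕ) : ℝ) * mixedVol 1 u w = P.derivative.eval 0 := by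
    have hfact := factorial_mul_mixedVol_one u w
    rw [sum_choose_mul_vol_sub hdeg hP, Nat.factorial_succ, Nat.cast_mul, mul_right_comm,
      mul_comm _ (P.coeff 1)] at hfact
    rw [mul_right_cancel₀ (Nat.cast_ne_zero.2 N.factorial_ne_zero) hfact,
      ← coeff_zero_eq_eval_zero, coeff_derivative]
    simp
  rw [hderiv]
  exact (P.hasDerivAt 0).hasDerivWithinAt.congr (fun h hh => (hP h hh).symm) (hP 0 le_rfl).symm

end MixedVolume

section DiniDerivative

/-- The upper right Dini derivative of `f` at `t` is at most `a`. -/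
def UpperRightDiniLE (f : ℝ → ℝ) (a t : ℝ) : Prop :=
  ∀ r > a, ∀ᶠ z in 𝓝[>] t, slope f t z < r

variable {f g : ℝ → ℝ} {a b t : ℝ}

lemma upperRightDiniLE_of_hasDerivWithinAt (h : HasDerivWithinAt f a (Ici t) t) :
    UpperRightDiniLE f a t := fun _ hr =>
  ((hasDerivWithinAt_iff_tendsto_slope' self_notMem_Ioi).1 h.Ioi_of_Ici).eventually_lt_const hr

lemma UpperRightDiniLE.mono (h : UpperRightDiniLE f a t) (hab : a ≤ b) :
    UpperRightDiniLE f b t := fun r hr =>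
  h r (hab.trans_lt hr)

lemma UpperRightDiniLE.of_eventually_le (hg : UpperRightDiniLE g a t)
    (hle : ∀ᶠ z in 𝓝[>] t, f z ≤ g z) (heq : f t = g t) : UpperRightDiniLE f a t := fun r hr => by
  filter_upwards [hg r hr, hle, self_mem_nhdsWithin] with z hz hfg (htz : t < z)
  refine lt_of_le_of_lt ?_ hz
  rw [slope_def_field, slope_def_field, heq]
  gcongr

lemma UpperRightDiniLE.of_tendsto {ι : Type*} {l : Filter ι} [l.NeBot] {A : ι → ℝ}
    (hA : Tendsto A l (𝓝 a)) (h : ∀ᶠ i in l, UpperRightDiniLE f (A i) t) :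
    UpperRightDiniLE f a t := fun r hr =>
  have ⟨_, hi, hr⟩ := (h.and (hA.eventually_lt_const hr)).exists
  hi r hr

lemma UpperRightDiniLE.sub (hf : UpperRightDiniLE f a t) (hg : HasDerivWithinAt g b (Ici t) t) :
    UpperRightDiniLE (fun s => f s - g s) (a - b) t := fun r hr => by
  have hf' := hf (a + (r - (a - b)) / 2) (by linarith)
  have hg' := ((hasDerivWithinAt_iff_tendsto_slope' self_notMem_Ioi).1
    hg.Ioi_of_Ici).eventually_const_lt (show b - (r - (a - b)) / 2 < b by linarith)
  filter_upwards [hf', hg'] with z hfz hgz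
  have hslope : slope (fun s => f s - g s) t z = slope f t z - slope g t z := by
    simp only [slope_def_field]
    ring
  linarith

lemma UpperRightDiniLE.of_comp_const_add (h : UpperRightDiniLE (fun s => f (t + s)) a 0) :
    UpperRightDiniLE f a t := fun r hr => by
  have hshift : Tendsto (fun z => z - t) (𝓝[>] t) (𝓝[>] 0) := by
    refine tendsto_nhdsWithin_iff.2
      ⟨?_, eventually_mem_nhdsWithin.mono fun z (hz : t < z) => mem_Ioi.2 (sub_pos.2 hz)⟩
    exact ((continuous_sub_right t).tendsto' t 0 (sub_self t)).mono_left nhdsWithin_le_nhds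
  filter_upwards [hshift.eventually (h r hr)] with z hz
  rwa [slope_def_field, add_sub_cancel, add_zero, sub_zero, ← slope_def_field] at hz

end DiniDerivative

lemma hasDerivWithinAt_integral_Ici {E : Type*} [NormedAddCommGroup E] [NormedSpace ℝ E]
    [CompleteSpace E] {f : ℝ → E} {a t : ℝ} (hf : ContinuousOn f (Ici a)) (ht : a ≤ t) :
    HasDerivWithinAt (fun x => ∫ s in a..x, f s) (f t) (Ici a) t := by
  have hcont : Continuous fun s => f (max a s) :=
    hf.comp_continuous (by fun_prop) fun s => le_max_left a s
  have hint : ∀ x ∈ Ici a, ∫ s in a..x, f s = ∫ s in a..x, f (max a s) := fun x hx =>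
    intervalIntegral.integral_congr fun s hs => by
      rw [uIcc_of_le hx] at hs
      rw [max_eq_right hs.1]
  have hderiv := (hcont.integral_hasStrictDerivAt a t).hasDerivAt.hasDerivWithinAt (s := Ici a)
  rw [max_eq_right ht] at hderiv
  exact hderiv.congr hint (hint t ht)

section VolumeDerivative

variable {n : ℕ} {A : EuclideanSpace ℝ (Fin n) →L[ℝ] EuclideanSpace ℝ (Fin n)}

lemma supp_expFlow_add_smul (c : ℝ) (K L : Conv n) {h : ℝ} (hh : 0 ≤ h)
    (p : EuclideanSpace ℝ (Fin n)) :
    supp (expFlow A c (K + h • L)) p = supp (expFlow A c K) p + h * supp (expFlow A c L) p := by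
  rw [expFlow, linImage_add_smul, supp_add_smul _ _ hh, expFlow, expFlow]

lemma expFlow_mono (c : ℝ) {K L : Conv n} (h : K ≤ L) : expFlow A c K ≤ expFlow A c L :=
  image_mono h

lemma hasDerivWithinAt_vol_expFlow_add_smul (hn : 1 ≤ n) (K L : Conv n) {c : ℝ → ℝ} {c' : ℝ}
    (hc0 : c 0 = 0) (hc : HasDerivWithinAt c c' (Ici 0) 0) :
    HasDerivWithinAt (fun h => vol (expFlow A (c h) (K + h • L)))
      (LinearMap.trace ℝ _ A.toLinearMap * c' * vol K + n * mixedVol 1 K L) (Ici 0) 0 := by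
  have hdet := ((hasDerivAt_abs_det_exp_smul A).comp_hasDerivWithinAt_of_eq (0 : ℝ) hc
    hc0.symm).mul (hasDerivWithinAt_vol_add_smul hn K L)
  have hone : |(NormedSpace.exp (c 0 • A)).det| = 1 := by
    rw [hc0, det_exp_zero_smul, abs_one]
  simp only [Function.comp_apply, hone, one_mul, zero_smul_convexBody, add_zero] at hdet
  refine hdet.congr (fun h _ => ?_) ?_ <;> exact vol_linImage _ _

variable {φ : ℝ → ℝ} {F : ℝ → Conv n → Conv n} {u₀ : Conv n} {U : ℝ → Conv n}

lemma SolvesIntegralEq.apply_zero (hU : SolvesIntegralEq A φ F u₀ U) : U 0 = u₀ := by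
  have hsupp : ∀ p, supp (U 0) p = supp u₀ p := fun p => by
    rw [hU.2 0 le_rfl p, intervalIntegral.integral_same, expFlow_zero,
      intervalIntegral.integral_same, add_zero]
  exact le_antisymm (le_of_forall_supp_le fun p => (hsupp p).le)
    (le_of_forall_supp_le fun p => (hsupp p).ge)

/-- The accumulated rate `∫₀ᵗ φ(V[U(s)]) ds` in the exponents of the integral equation. -/
noncomputable def rateIntegral (φ : ℝ → ℝ) (U : ℝ → Conv n) (t : ℝ) : ℝ :=
  ∫ s in (0 : ℝ)..t, φ (vol (U s))

lemma rateIntegral_zero (φ : ℝ → ℝ) (U : ℝ → Conv n) : rateIntegral φ U 0 = 0 :=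
  intervalIntegral.integral_same

lemma continuousOn_rate (hφ : ContinuousOn φ (Ici 0)) (hU : ContinuousOn U (Ici 0)) :
    ContinuousOn (fun s => φ (vol (U s))) (Ici 0) :=
  hφ.comp (continuous_vol.comp_continuousOn hU) fun _ _ => vol_nonneg _

lemma hasDerivWithinAt_rateIntegral (hφ : ContinuousOn φ (Ici 0)) (hU : ContinuousOn U (Ici 0))
    {t : ℝ} (ht : 0 ≤ t) : HasDerivWithinAt (rateIntegral φ U) (φ (vol (U t))) (Ici 0) t :=
  hasDerivWithinAt_integral_Ici (continuousOn_rate hφ hU) ht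

lemma continuousOn_rateIntegral (hφ : ContinuousOn φ (Ici 0)) (hU : ContinuousOn U (Ici 0)) :
    ContinuousOn (rateIntegral φ U) (Ici 0) := fun _ ht =>
  (hasDerivWithinAt_rateIntegral hφ hU ht).continuousWithinAt

lemma integral_rate_eq_sub (hφ : ContinuousOn φ (Ici 0)) (hU : ContinuousOn U (Ici 0)) {s t : ℝ}
    (hs : 0 ≤ s) (ht : 0 ≤ t) :
    ∫ τ in s..t, φ (vol (U τ)) = rateIntegral φ U t - rateIntegral φ U s := by
  have hint : ∀ x, 0 ≤ x → IntervalIntegrable (fun τ => φ (vol (U τ))) volume 0 x := fun x hx =>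
    ((continuousOn_rate hφ hU).mono (by grind [uIcc_of_le])).intervalIntegrable
  exact (intervalIntegral.integral_interval_sub_left (hint t ht) (hint s hs)).symm

lemma continuousOn_forcing (hF : ContinuousOn (fun q : ℝ × Conv n => F q.1 q.2) (Ici 0 ×ˢ univ))
    (hU : ContinuousOn U (Ici 0)) : ContinuousOn (fun s => F (vol (U s)) (U s)) (Ici 0) :=
  hF.comp ((continuous_vol.comp_continuousOn hU).prodMk hU) fun _ _ => ⟨vol_nonneg _, mem_univ _⟩

/-- The right-hand side is `u₀ + h L` transported as a whole: the forcing, pulled back to time `0`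
along the flow, is bounded by `L`. -/
lemma SolvesIntegralEq.le_expFlow (hU : SolvesIntegralEq A φ F u₀ U)
    (hφ : ContinuousOn φ (Ici 0))
    (hF : ContinuousOn (fun q : ℝ × Conv n => F q.1 q.2) (Ici 0 ×ˢ univ)) {L : Conv n} {h : ℝ}
    (hh : 0 ≤ h)
    (hL : ∀ s ∈ Icc 0 h, expFlow A (-rateIntegral φ U s) (F (vol (U s)) (U s)) ≤ L) :
    U h ≤ expFlow A (rateIntegral φ U h) (u₀ + h • L) := by
  obtain ⟨hUcont, hUeq⟩ := hU
  set c := rateIntegral φ U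
  set f := fun s => F (vol (U s)) (U s)
  have hIcc : Icc 0 h ⊆ Ici 0 := Icc_subset_Ici_self
  refine le_of_forall_supp_le fun p => ?_
  have hintegrand : EqOn (fun s => supp (expFlow A (∫ τ in s..h, φ (vol (U τ))) (f s)) p)
      (fun s => supp (expFlow A (c h - c s) (f s)) p) (uIcc 0 h) := fun s hs => by
    rw [uIcc_of_le hh] at hs
    simp only [integral_rate_eq_sub hφ hUcont hs.1 hh, c]
  have hcont : ContinuousOn (fun s => supp (expFlow A (c h - c s) (f s)) p) (Icc 0 h) :=
    (continuous_supp p).comp_continuousOn <| (continuous_expFlow A).comp_continuousOn <|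
      (continuousOn_const.sub ((continuousOn_rateIntegral hφ hUcont).mono hIcc)).prodMk
        ((continuousOn_forcing hF hUcont).mono hIcc)
  have hle : ∀ s ∈ Icc 0 h, expFlow A (c h - c s) (f s) ≤ expFlow A (c h) L := fun s hs => by
    rw [sub_eq_add_neg, ← expFlow_expFlow]
    exact expFlow_mono _ (hL s hs)
  calc supp (U h) p = supp (expFlow A (c h) u₀) p +
        ∫ s in (0 : ℝ)..h, supp (expFlow A (c h - c s) (f s)) p := by
        rw [hUeq h hh p, intervalIntegral.integral_congr hintegrand]
        rfl
    _ ≤ supp (expFlow A (c h) u₀) p + ∫ _ in (0 : ℝ)..h, supp (expFlow A (c h) L) p := by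
        gcongr
        exact intervalIntegral.integral_mono_on hh
          (hcont.intervalIntegrable_of_Icc hh) intervalIntegrable_const
          fun s hs => supp_mono (hle s hs) p
    _ = supp (expFlow A (c h) (u₀ + h • L)) p := by
        rw [supp_expFlow_add_smul _ _ _ hh, intervalIntegral.integral_const, sub_zero, smul_eq_mul]

theorem SolvesIntegralEq.upperRightDiniLE_vol (hn : 1 ≤ n) (hU : SolvesIntegralEq A φ F u₀ U)
    (hφ : ContinuousOn φ (Ici 0))
    (hF : ContinuousOn (fun q : ℝ × Conv n => F q.1 q.2) (Ici 0 ×ˢ univ)) :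
    UpperRightDiniLE (fun t => vol (U t)) (LinearMap.trace ℝ _ A.toLinearMap * φ (vol u₀) * vol u₀ +
      n * mixedVol 1 u₀ (F (vol u₀) u₀)) 0 := by
  set F₀ := F (vol u₀) u₀
  set B := unitBall (EuclideanSpace ℝ (Fin n))
  have hzero : U 0 = u₀ := hU.apply_zero
  have hlim : Tendsto (fun ε : ℝ => LinearMap.trace ℝ _ A.toLinearMap * φ (vol u₀) * vol u₀ +
      n * mixedVol 1 u₀ (F₀ + ε • B)) (𝓝[>] 0)
      (𝓝 (LinearMap.trace ℝ _ A.toLinearMap * φ (vol u₀) * vol u₀ + n * mixedVol 1 u₀ F₀)) :=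
    ((((continuous_mixedVol 1 u₀).tendsto F₀).comp
      ((tendsto_add_smul F₀ B).mono_left nhdsWithin_le_nhds)).const_mul _).const_add _
  refine .of_tendsto hlim (eventually_mem_nhdsWithin.mono fun ε (hε : 0 < ε) => ?_)
  have hpull : ContinuousOn (fun s => expFlow A (-rateIntegral φ U s) (F (vol (U s)) (U s)))
      (Ici 0) :=
    (continuous_expFlow A).comp_continuousOn
      ((continuousOn_rateIntegral hφ hU.1).neg.prodMk (continuousOn_forcing hF hU.1))
  have hnear : ∀ᶠ s in 𝓝[≥] 0,
      expFlow A (-rateIntegral φ U s) (F (vol (U s)) (U s)) ≤ F₀ + ε • B := by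
    have hdist := (hpull 0 self_mem_Ici).eventually (Metric.closedBall_mem_nhds _ hε)
    simp only [rateIntegral_zero, neg_zero, expFlow_zero, hzero] at hdist
    exact hdist.mono fun s hs => le_add_smul_unitBall hs
  obtain ⟨δ, hδ, hδnear⟩ := mem_nhdsGE_iff_exists_Icc_subset.1 hnear
  have hderiv := hasDerivWithinAt_vol_expFlow_add_smul (A := A) hn u₀ (F₀ + ε • B)
    (rateIntegral_zero φ U) (hasDerivWithinAt_rateIntegral hφ hU.1 le_rfl)
  rw [hzero] at hderiv
  refine (upperRightDiniLE_of_hasDerivWithinAt hderiv).of_eventually_le ?_ ?_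
  · filter_upwards [Ioc_mem_nhdsGT hδ] with h hh
    exact vol_mono (hU.le_expFlow hφ hF hh.1.le fun s hs =>
      hδnear ⟨hs.1, hs.2.trans hh.2⟩)
  · rw [rateIntegral_zero, expFlow_zero, zero_smul_convexBody, add_zero, hzero]

end VolumeDerivative

section Peano

lemma exists_subseq_tendsto_of_lipschitzWith {X : Type*} [MetricSpace X] [ProperSpace X]
    {K : NNReal} {y : ℕ → ℝ → X} {x₀ : X} {a b : ℝ} (hab : a ≤ b) (hy : ∀ m, LipschitzWith K (y m))
    (ha : ∀ m, y m a = x₀) : ∃ σ : ℕ → ℕ, StrictMono σ ∧ ∃ x : ℝ → X, Continuous x ∧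
      ∀ t ∈ Icc a b, Tendsto (fun m => y (σ m) t) atTop (𝓝 (x t)) := by
  let Y : ℕ → BoundedContinuousFunction (Icc a b) X := fun m =>
    .mkOfCompact ⟨fun t => y m t, (hy m).continuous.comp continuous_subtype_val⟩
  have hcompact : IsCompact (closure (range Y)) := by
    refine BoundedContinuousFunction.arzela_ascoli (Metric.closedBall x₀ (K * (b - a)))
      (isCompact_closedBall _ _) _ ?_ ?_
    · rintro _ t ⟨m, rfl⟩
      calc dist (y m t) x₀ = dist (y m t) (y m a) := by rw [ha]
        _ ≤ K * dist (t : ℝ) a := (hy m).dist_le_mul _ _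
        _ ≤ K * (b - a) := by
          gcongr
          rw [Real.dist_eq, abs_of_nonneg (sub_nonneg.2 t.2.1)]
          exact sub_le_sub_right t.2.2 a
    · refine (LipschitzWith.uniformEquicontinuous _ K ?_).equicontinuous
      rintro ⟨_, m, rfl⟩
      exact fun t t' => hy m t t'
  obtain ⟨z, -, σ, hσ, hz⟩ := hcompact.tendsto_subseq fun m => subset_closure (mem_range_self m)
  refine ⟨σ, hσ, fun t => z (projIcc a b hab t), z.continuous.comp continuous_projIcc,
    fun t ht => ?_⟩
  simp only [projIcc_of_mem hab ht]
  exact ((BoundedContinuousFunction.lipschitz_eval_const (⟨t, ht⟩ : Icc a b)).continuous.tendsto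
    z).comp hz

variable {E : Type*} [NormedAddCommGroup E] [NormedSpace ℝ E]

/-- Iterates of the integral operator with delay `δ` of Tonelli's scheme for the initial value
problem `x' = G(t, x)`, `x(t₀) = x₀`. -/
noncomputable def delayIterate (G : ℝ → E → E) (t₀ : ℝ) (x₀ : E) (δ : ℝ) : ℕ → ℝ → E
  | 0, _ => x₀
  | j + 1, t => x₀ + ∫ s in t₀..t, G s (delayIterate G t₀ x₀ δ j (max (s - δ) t₀))

variable {G : ℝ → E → E} {t₀ : ℝ} {x₀ : E} {δ : ℝ} {M : NNReal}

lemma delayIterate_apply_self (j : ℕ) : delayIterate G t₀ x₀ δ j t₀ = x₀ := by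
  cases j with
  | zero => rfl
  | succ j => rw [delayIterate, intervalIntegral.integral_same, add_zero]

lemma delayIterate_succ_eq (hδ : 0 ≤ δ) (j : ℕ) :
    ∀ t ∈ Icc t₀ (t₀ + j * δ), delayIterate G t₀ x₀ δ (j + 1) t = delayIterate G t₀ x₀ δ j t := by
  induction j with
  | zero =>
    intro t ht
    obtain rfl : t = t₀ := by simpa using ht
    rw [delayIterate_apply_self, delayIterate_apply_self]
  | succ j ih =>
    intro t ht
    rw [delayIterate, delayIterate]
    refine congrArg (x₀ + ·) (intervalIntegral.integral_congr fun s hs => ?_)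
    rw [uIcc_of_le ht.1] at hs
    have hdelay : max (s - δ) t₀ ≤ t₀ + j * δ := by
      have := ht.2
      push_cast at this
      exact max_le (by linarith [hs.2]) (le_add_of_nonneg_right (by positivity))
    exact congrArg (G s) (ih _ ⟨le_max_right _ _, hdelay⟩)

lemma lipschitzWith_delayIterate (hG : Continuous fun q : ℝ × E => G q.1 q.2)
    (hM : ∀ t x, ‖G t x‖ ≤ M) (j : ℕ) : LipschitzWith M (delayIterate G t₀ x₀ δ j) := by
  induction j with
  | zero => exact LipschitzWith.const' x₀
  | succ j ih =>
    have hcont : Continuous fun s => G s (delayIterate G t₀ x₀ δ j (max (s - δ) t₀)) :=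
      hG.comp (continuous_id.prodMk (ih.continuous.comp (by fun_prop)))
    refine LipschitzWith.of_dist_le_mul fun t t' => ?_
    rw [delayIterate, delayIterate, dist_add_left, dist_eq_norm,
      intervalIntegral.integral_interval_sub_left (hcont.intervalIntegrable _ _)
        (hcont.intervalIntegrable _ _)]
    exact intervalIntegral.norm_integral_le_of_norm_le_const fun s _ => hM s _

lemma exists_delayed_solution (hG : Continuous fun q : ℝ × E => G q.1 q.2)
    (hM : ∀ t x, ‖G t x‖ ≤ M) (t₀ : ℝ) (x₀ : E) (τ : ℝ) (hδ : 0 < δ) :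
    ∃ x : ℝ → E, LipschitzWith M x ∧ x t₀ = x₀ ∧
      ∀ t ∈ Icc t₀ τ, x t = x₀ + ∫ s in t₀..t, G s (x (max (s - δ) t₀)) := by
  obtain ⟨j, hj⟩ := exists_nat_ge ((τ - t₀) / δ)
  have hτ : τ ≤ t₀ + j * δ := by linarith [(div_le_iff₀ hδ).1 hj]
  refine ⟨delayIterate G t₀ x₀ δ j, lipschitzWith_delayIterate hG hM j, delayIterate_apply_self j,
    fun t ht => ?_⟩
  rw [← delayIterate_succ_eq hδ.le j t ⟨ht.1, ht.2.trans hτ⟩, delayIterate]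

variable [FiniteDimensional ℝ E]

lemma exists_integral_eq_of_continuous_of_bounded (hG : Continuous fun q : ℝ × E => G q.1 q.2)
    (hM : ∀ t x, ‖G t x‖ ≤ M) (x₀ : E) {τ : ℝ} (hτ : t₀ ≤ τ) :
    ∃ x : ℝ → E, Continuous x ∧ ∀ t ∈ Icc t₀ τ, x t = x₀ + ∫ s in t₀..t, G s (x s) := by
  have : ProperSpace E := FiniteDimensional.proper ℝ E
  let δ : ℕ → ℝ := fun m => 1 / (m + 1)
  choose y hylip hy₀ hyeq using fun m =>
    exists_delayed_solution hG hM t₀ x₀ τ (Nat.one_div_pos_of_nat (α := ℝ) (n := m))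
  obtain ⟨σ, hσ, x, hx, hlim⟩ := exists_subseq_tendsto_of_lipschitzWith hτ hylip hy₀
  have hδlim : Tendsto (fun m => δ (σ m)) atTop (𝓝 0) :=
    tendsto_one_div_add_atTop_nhds_zero_nat.comp hσ.tendsto_atTop
  have hlim_delayed : ∀ t ∈ Icc t₀ τ,
      Tendsto (fun m => y (σ m) (max (t - δ (σ m)) t₀)) atTop (𝓝 (x t)) := fun t ht => by
    have hdelay : Tendsto (fun m => M * dist t (max (t - δ (σ m)) t₀)) atTop (𝓝 0) := by
      have := (tendsto_const_nhds (x := t)).dist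
        ((hδlim.const_sub t).max (tendsto_const_nhds (x := t₀)))
      rw [sub_zero, max_eq_left ht.1, dist_self] at this
      simpa only [mul_zero] using this.const_mul (M : ℝ)
    exact tendsto_of_tendsto_of_dist (hlim t ht)
      (squeeze_zero (fun _ => dist_nonneg) (fun m => (hylip _).dist_le_mul _ _) hdelay)
  refine ⟨x, hx, fun t ht => tendsto_nhds_unique (hlim t ht) ?_⟩
  have hint : Tendsto (fun m => ∫ s in t₀..t, G s (y (σ m) (max (s - δ (σ m)) t₀))) atTop
      (𝓝 (∫ s in t₀..t, G s (x s))) := by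
    refine intervalIntegral.tendsto_integral_filter_of_dominated_convergence (fun _ => M)
      (.of_forall fun m => Continuous.aestronglyMeasurable ?_)
      (.of_forall fun m => .of_forall fun s _ => hM _ _) intervalIntegrable_const
      (.of_forall fun s hs => ?_)
    · exact hG.comp (continuous_id.prodMk ((hylip _).continuous.comp (by fun_prop)))
    · rw [uIoc_of_le ht.1] at hs
      exact (hG.tendsto (s, x s)).comp
        (tendsto_const_nhds.prodMk_nhds (hlim_delayed s ⟨hs.1.le, hs.2.trans ht.2⟩))
  simp only [hyeq _ t ht]
  exact hint.const_add x₀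

theorem exists_eventually_hasDerivAt_of_continuous (hG : Continuous fun q : ℝ × E => G q.1 q.2)
    (t₀ : ℝ) (x₀ : E) :
    ∃ x : ℝ → E, x t₀ = x₀ ∧ ∀ᶠ t in 𝓝[≥] t₀, HasDerivAt x (G t (x t)) t := by
  have : CompleteSpace E := FiniteDimensional.complete ℝ E
  let χ : ContDiffBump (t₀, x₀) := ⟨1, 2, one_pos, one_lt_two⟩
  have hcont : Continuous fun q : ℝ × E => χ q • G q.1 q.2 := χ.continuous.smul hG
  obtain ⟨M, hM⟩ := χ.hasCompactSupport.smul_right.exists_bound_of_continuous hcont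
  obtain ⟨y, hy, hyeq⟩ := exists_integral_eq_of_continuous_of_bounded (t₀ := t₀)
    (G := fun t x => χ (t, x) • G t x) (M := M.toNNReal) hcont
    (fun t x => (hM (t, x)).trans (Real.le_coe_toNNReal M)) x₀ (lt_add_one t₀).le
  let x : ℝ → E := fun t => x₀ + ∫ s in t₀..t, χ (s, y s) • G s (y s)
  have hderiv : ∀ t, HasDerivAt x (χ (t, y t) • G t (y t)) t := fun t =>
    ((hcont.comp (continuous_id.prodMk hy)).integral_hasStrictDerivAt t₀ t).hasDerivAt.const_add x₀
  have hy₀ : y t₀ = x₀ := by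
    rw [hyeq t₀ (left_mem_Icc.2 (lt_add_one t₀).le), intervalIntegral.integral_same, add_zero]
  have hnear : ∀ᶠ t in 𝓝[≥] t₀, χ (t, y t) = 1 :=
    (((continuous_id.prodMk hy).tendsto' t₀ (t₀, x₀) (by rw [id, hy₀])).eventually
      χ.eventuallyEq_one).filter_mono nhdsWithin_le_nhds
  refine ⟨x, by rw [← hy₀, hyeq t₀ (left_mem_Icc.2 (lt_add_one t₀).le)], ?_⟩
  filter_upwards [hnear, Icc_mem_nhdsGE (lt_add_one t₀)] with t hχ ht
  have hxt : x t = y t := (hyeq t ht).symm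
  simpa only [hχ, one_smul, hxt] using hderiv t

end Peano

section Comparison

variable {m : ℕ} {g : (Fin m → ℝ) → Fin m → ℝ} {w : ℝ → Fin m → ℝ}

/-- `w` is a curve in the cone satisfying the differential inequality `w' ≤ g(w)` on `[0, ∞)`, with
upper right Dini derivatives. -/
structure IsSubsolution (g : (Fin m → ℝ) → Fin m → ℝ) (w : ℝ → Fin m → ℝ) : Prop where
  continuousOn : ContinuousOn w (Ici 0)
  mem_cone : ∀ t, 0 ≤ t → w t ∈ cone m
  upperRightDiniLE : ∀ t, 0 ≤ t → ∀ i, UpperRightDiniLE (fun s => w s i) (g (w t) i) t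

lemma sup_mem_cone {x : Fin m → ℝ} (hx : x ∈ cone m) (y : Fin m → ℝ) : x ⊔ y ∈ cone m := fun i =>
  (hx i).trans le_sup_left

lemma Wazewski.le_sup (hW : Wazewski g) {x y : Fin m → ℝ} (hx : x ∈ cone m) {i : Fin m}
    (hi : y i ≤ x i) : g x i ≤ g (x ⊔ y) i :=
  hW i x hx _ (sup_mem_cone hx y) le_sup_left (sup_eq_left.2 hi).symm

/-- Solutions of the system truncated from below by a subsolution cannot cross it: where `x i < w i`
the Ważewski condition gives `(w i)' ≤ (x i)'`. -/
lemma IsSubsolution.le_of_hasDerivAt_sup (hw : IsSubsolution g w) (hW : Wazewski g) {a b : ℝ}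
    (ha : 0 ≤ a) {x : ℝ → Fin m → ℝ} (hxa : w a ≤ x a)
    (hx : ∀ t ∈ Icc a b, HasDerivAt x (g (w t ⊔ x t)) t) {t : ℝ} (ht : t ∈ Icc a b) :
    w t ≤ x t := fun i => by
  have hxi : ∀ s ∈ Icc a b, HasDerivAt (fun s => x s i) (g (w s ⊔ x s) i) s := fun s hs =>
    hasDerivAt_pi.1 (hx s hs) i
  have hcont : ContinuousOn (fun s => w s i - x s i) (Icc a b) :=
    ((continuousOn_pi.1 hw.continuousOn i).mono fun s hs => ha.trans hs.1).sub
      fun s hs => (hxi s hs).continuousAt.continuousWithinAt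
  have hbound : ∀ ε > 0, w t i - x t i ≤ ε * (1 + (t - a)) := fun ε hε => by
    have hline : ∀ s, HasDerivAt (fun s => ε * (1 + (s - a))) ε s := fun s => by
      simpa only [id, mul_one] using (((hasDerivAt_id s).sub_const a).const_add 1).const_mul ε
    refine image_le_of_liminf_slope_right_lt_deriv_boundary hcont
      (fun s hs r hr => (((hw.upperRightDiniLE s (ha.trans hs.1) i).sub
        (hxi s ⟨hs.1, hs.2.le⟩).hasDerivWithinAt) r hr).frequently) ?_ hline ?_ ht
    · linarith [hxa i]
    · intro s hs heq
      have hpos : 0 < ε * (1 + (s - a)) := mul_pos hε (by linarith [hs.1])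
      linarith [hW.le_sup (hw.mem_cone s (ha.trans hs.1)) (y := x s) (i := i) (by linarith)]
  have hlim : Tendsto (fun ε => ε * (1 + (t - a))) (𝓝[>] 0) (𝓝 0) :=
    ((continuous_mul_const _).tendsto' 0 0 (zero_mul _)).mono_left nhdsWithin_le_nhds
  exact sub_nonpos.1 (ge_of_tendsto hlim (eventually_mem_nhdsWithin.mono hbound))

lemma IsSubsolution.exists_local_solution_ge (hw : IsSubsolution g w)
    (hg : ContinuousOn g (cone m)) (hW : Wazewski g) {T : ℝ} (hT : 0 ≤ T) {η : Fin m → ℝ}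
    (hη : w T ≤ η) : ∃ x : ℝ → Fin m → ℝ, x T = η ∧ ∃ τ > T, ∀ t ∈ Icc T τ,
      w t ≤ x t ∧ HasDerivAt x (g (x t)) t := by
  have hwcont : Continuous fun t => w (max t 0) :=
    hw.continuousOn.comp_continuous (by fun_prop) fun t => mem_Ici.2 (le_max_right t 0)
  have hsup : Continuous fun q : ℝ × (Fin m → ℝ) => w (max q.1 0) ⊔ q.2 :=
    continuous_pi fun i => ((continuous_apply i).comp (hwcont.comp continuous_fst)).sup
      ((continuous_apply i).comp continuous_snd)
  have hcont : Continuous fun q : ℝ × (Fin m → ℝ) => g (w (max q.1 0) ⊔ q.2) :=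
    hg.comp_continuous hsup fun q => sup_mem_cone (hw.mem_cone _ (le_max_right _ _)) _
  obtain ⟨x, hxT, hx⟩ := exists_eventually_hasDerivAt_of_continuous
    (G := fun t x => g (w (max t 0) ⊔ x)) hcont T η
  obtain ⟨τ, hτ, hxτ⟩ := mem_nhdsGE_iff_exists_Icc_subset.1 hx
  have hderiv : ∀ t ∈ Icc T τ, HasDerivAt x (g (w t ⊔ x t)) t := fun t ht => by
    have hxt : HasDerivAt x (g (w (max t 0) ⊔ x t)) t := hxτ ht
    rwa [max_eq_left (hT.trans ht.1)] at hxt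
  refine ⟨x, hxT, τ, hτ, fun t ht => ?_⟩
  have hle := hw.le_of_hasDerivAt_sup hW hT (hxT ▸ hη) hderiv ht
  exact ⟨hle, by simpa only [sup_eq_right.2 hle] using hderiv t ht⟩

/-- `x` solves `x' = g(x)`, `x(0) = η`, and dominates `w` on `[0, T)`; the end `T` may be `∞`. -/
structure IsDominatingSolution (g : (Fin m → ℝ) → Fin m → ℝ) (w : ℝ → Fin m → ℝ) (η : Fin m → ℝ)
    (T : EReal) (x : ℝ → Fin m → ℝ) : Prop where
  pos : 0 < T
  apply_zero : x 0 = η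
  le : ∀ t : ℝ, 0 ≤ t → t < T → w t ≤ x t
  hasDerivWithinAt : ∀ t : ℝ, 0 ≤ t → t < T → HasDerivWithinAt x (g (x t)) (Ici 0) t

variable {η : Fin m → ℝ}

lemma IsDominatingSolution.isSolutionOn {T : EReal} {x : ℝ → Fin m → ℝ} {I : Set ℝ}
    (hx : IsDominatingSolution g w η T x) (hw : IsSubsolution g w) (hI : I ⊆ Ici 0)
    (hIT : ∀ t ∈ I, (t : EReal) < T) : IsSolutionOn g I x := fun t ht =>
  ⟨fun i => (hw.mem_cone t (hI ht) i).trans (hx.le t (hI ht) (hIT t ht) i),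
    (hx.hasDerivWithinAt t (hI ht) (hIT t ht)).mono hI⟩

lemma IsSubsolution.exists_isDominatingSolution (hw : IsSubsolution g w)
    (hg : ContinuousOn g (cone m)) (hW : Wazewski g) (hη : w 0 ≤ η) :
    ∃ T x, IsDominatingSolution g w η T x := by
  obtain ⟨x, hx₀, τ, hτ, hx⟩ := hw.exists_local_solution_ge hg hW le_rfl hη
  have hmem : ∀ t : ℝ, 0 ≤ t → (t : EReal) < τ → t ∈ Icc 0 τ := fun t ht htτ =>
    ⟨ht, (EReal.coe_lt_coe_iff.1 htτ).le⟩
  exact ⟨τ, x, EReal.coe_pos.2 hτ, hx₀, fun t ht htτ => (hx t (hmem t ht htτ)).1,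
    fun t ht htτ => (hx t (hmem t ht htτ)).2.hasDerivWithinAt⟩

lemma hasDerivWithinAt_ite_le {E : Type*} [NormedAddCommGroup E] [NormedSpace ℝ E]
    {f₁ f₂ : ℝ → E} {f' : E} {s : Set ℝ} {T t : ℝ} (hT : f₁ T = f₂ T)
    (h₁ : t ≤ T → HasDerivWithinAt f₁ f' s t) (h₂ : T ≤ t → HasDerivWithinAt f₂ f' s t) :
    HasDerivWithinAt (fun t => if t ≤ T then f₁ t else f₂ t) f' s t := by
  have hge : ∀ t, T ≤ t → (if t ≤ T then f₁ t else f₂ t) = f₂ t := fun t ht => by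
    split_ifs with h
    · rw [le_antisymm h ht, hT]
    · rfl
  rw [← inter_univ s, ← Iic_union_Ici (a := T), inter_union_distrib_left]
  refine .union ?_ ?_
  · by_cases ht : t ≤ T
    · exact ((h₁ ht).mono inter_subset_left).congr (fun r hr => if_pos hr.2) (if_pos ht)
    · exact HasFDerivWithinAt.of_notMem_closure fun h =>
        ht (closure_minimal inter_subset_right isClosed_Iic h)
  · by_cases ht : T ≤ t
    · exact ((h₂ ht).mono inter_subset_left).congr (fun r hr => hge r hr.2) (hge t ht)
    · exact HasFDerivWithinAt.of_notMem_closure fun h =>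
        ht (closure_minimal inter_subset_right isClosed_Ici h)

lemma IsDominatingSolution.exists_extension {T : ℝ} {x ζ : ℝ → Fin m → ℝ}
    (hx : IsDominatingSolution g w η T x) (hw : IsSubsolution g w) (hg : ContinuousOn g (cone m))
    (hW : Wazewski g) (hζ : IsSolutionOn g (Ici 0) ζ) (hζx : EqOn ζ x (Ico 0 T)) :
    ∃ (T' : EReal) (y : ℝ → Fin m → ℝ), IsDominatingSolution g w η T' y ∧ T < T' ∧
      EqOn y x (Ico 0 T) := by
  have hT : 0 < T := EReal.coe_pos.1 hx.pos
  have hwζ : ∀ t ∈ Icc 0 T, w t ≤ ζ t := fun t ht =>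
    ContinuousWithinAt.closure_le (closure_Ico hT.ne ▸ ht)
      ((hw.continuousOn t ht.1).mono Ico_subset_Ici_self)
      ((hζ t ht.1).2.continuousWithinAt.mono Ico_subset_Ici_self)
      fun s hs => hζx hs ▸ hx.le s hs.1 (EReal.coe_lt_coe_iff.2 hs.2)
  obtain ⟨z, hzT, τ, hτ, hz⟩ := hw.exists_local_solution_ge hg hW hT.le
    (hwζ T (right_mem_Icc.2 hT.le))
  let y : ℝ → Fin m → ℝ := fun t => if t ≤ T then ζ t else z t
  have hyζ : ∀ t ≤ T, y t = ζ t := fun t ht => if_pos ht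
  have hyz : ∀ t, T ≤ t → y t = z t := fun t ht => by
    rcases ht.eq_or_lt with rfl | ht
    · rw [hyζ T le_rfl, hzT]
    · exact if_neg ht.not_ge
  refine ⟨τ, y, ⟨EReal.coe_pos.2 (hT.trans hτ), ?_, fun t ht htτ => ?_, fun t ht htτ => ?_⟩,
    EReal.coe_lt_coe_iff.2 hτ, fun t ht => (hyζ t ht.2.le).trans (hζx ht)⟩
  · rw [hyζ 0 hT.le, hζx (left_mem_Ico.2 hT), hx.apply_zero]
  · rcases le_total t T with htT | hTt
    · exact hyζ t htT ▸ hwζ t ⟨ht, htT⟩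
    · exact hyz t hTt ▸ (hz t ⟨hTt, (EReal.coe_lt_coe_iff.1 htτ).le⟩).1
  · exact hasDerivWithinAt_ite_le hzT.symm (fun htT => hyζ t htT ▸ (hζ t ht).2)
      fun hTt => hyz t hTt ▸ (hz t ⟨hTt, (EReal.coe_lt_coe_iff.1 htτ).le⟩).2.hasDerivWithinAt

/-- The pair `q` of a time and a curve extends the pair `p`: the order used with Zorn's lemma. -/
def Extends (p q : EReal × (ℝ → Fin m → ℝ)) : Prop :=
  p.1 ≤ q.1 ∧ ∀ t : ℝ, 0 ≤ t → t < p.1 → q.2 t = p.2 t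

lemma Extends.trans {p q r : EReal × (ℝ → Fin m → ℝ)} (hpq : Extends p q) (hqr : Extends q r) :
    Extends p r :=
  ⟨hpq.1.trans hqr.1, fun t ht htp =>
    (hqr.2 t ht (htp.trans_le hpq.1)).trans (hpq.2 t ht htp)⟩

open Classical in
lemma exists_eq_of_isChain {c : Set (EReal × (ℝ → Fin m → ℝ))} (hc : IsChain Extends c) :
    ∃ x : ℝ → Fin m → ℝ, ∀ p ∈ c, ∀ t : ℝ, 0 ≤ t → t < p.1 → x t = p.2 t := by
  have hagree : ∀ p ∈ c, ∀ q ∈ c, ∀ t : ℝ, 0 ≤ t → t < p.1 → t < q.1 → p.2 t = q.2 t := by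
    intro p hp q hq t ht htp htq
    rcases eq_or_ne p q with rfl | hne
    · rfl
    rcases hc hp hq hne with h | h
    · exact (h.2 t ht htp).symm
    · exact h.2 t ht htq
  refine ⟨fun t => if h : ∃ p ∈ c, (t : EReal) < p.1 then h.choose.2 t else 0,
    fun p hp t ht htp => ?_⟩
  have h : ∃ p ∈ c, (t : EReal) < p.1 := ⟨p, hp, htp⟩
  exact (dif_pos h).trans (hagree _ h.choose_spec.1 p hp t ht h.choose_spec.2 htp)

lemma isDominatingSolution_sSup {c : Set (EReal × (ℝ → Fin m → ℝ))} (hne : c.Nonempty)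
    (hc : ∀ p ∈ c, IsDominatingSolution g w η p.1 p.2) {x : ℝ → Fin m → ℝ}
    (hx : ∀ p ∈ c, ∀ t : ℝ, 0 ≤ t → t < p.1 → x t = p.2 t) :
    IsDominatingSolution g w η (sSup (Prod.fst '' c)) x := by
  have hmem : ∀ t : ℝ, t < sSup (Prod.fst '' c) → ∃ p ∈ c, (t : EReal) < p.1 := fun t ht => by
    obtain ⟨_, ⟨p, hp, rfl⟩, htp⟩ := lt_sSup_iff.1 ht
    exact ⟨p, hp, htp⟩
  obtain ⟨p₀, hp₀⟩ := hne
  refine ⟨(hc p₀ hp₀).pos.trans_le (le_sSup (mem_image_of_mem _ hp₀)), ?_,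
    fun t ht htc => ?_, fun t ht htc => ?_⟩
  · rw [hx p₀ hp₀ 0 le_rfl (hc p₀ hp₀).pos, (hc p₀ hp₀).apply_zero]
  · obtain ⟨p, hp, htp⟩ := hmem t htc
    exact hx p hp t ht htp ▸ (hc p hp).le t ht htp
  · obtain ⟨p, hp, htp⟩ := hmem t htc
    rw [hx p hp t ht htp]
    refine ((hc p hp).hasDerivWithinAt t ht htp).congr_of_eventuallyEq ?_ (hx p hp t ht htp)
    filter_upwards [self_mem_nhdsWithin, nhdsWithin_le_nhds
      ((continuous_coe_real_ereal.tendsto t).eventually_lt_const htp)] with s hs hsp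
    exact hx p hp s hs hsp

theorem IsSubsolution.exists_solution_ge (hw : IsSubsolution g w) (hg : ContinuousOn g (cone m))
    (hW : Wazewski g) (hη : w 0 ≤ η)
    (hext : ∀ (T : ℝ) (ξ : ℝ → Fin m → ℝ), 0 < T → IsSolutionOn g (Ico 0 T) ξ → ξ 0 = η →
      ∃ ζ : ℝ → Fin m → ℝ, IsSolutionOn g (Ici 0) ζ ∧ EqOn ζ ξ (Ico 0 T)) :
    ∃ x : ℝ → Fin m → ℝ, x 0 = η ∧ IsSolutionOn g (Ici 0) x ∧ ∀ t, 0 ≤ t → w t ≤ x t := by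
  let Sol := {p : EReal × (ℝ → Fin m → ℝ) // IsDominatingSolution g w η p.1 p.2}
  have hchain : ∀ c : Set Sol, IsChain (fun p q => Extends p.1 q.1) c →
      ∃ ub : Sol, ∀ p ∈ c, Extends p.1 ub.1 := by
    intro c hc
    rcases c.eq_empty_or_nonempty with rfl | hne
    · obtain ⟨T, x, hx⟩ := hw.exists_isDominatingSolution hg hW hη
      exact ⟨⟨(T, x), hx⟩, fun p hp => hp.elim⟩
    · obtain ⟨x, hx⟩ := exists_eq_of_isChain
        (hc.image_of_map_rel _ Extends Subtype.val fun _ _ h => h)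
      have hsup := isDominatingSolution_sSup (hne.image _)
        (by rintro _ ⟨p, -, rfl⟩; exact p.2) hx
      exact ⟨⟨(_, x), hsup⟩, fun p hp =>
        ⟨le_sSup (mem_image_of_mem _ (mem_image_of_mem _ hp)), hx _ (mem_image_of_mem _ hp)⟩⟩
  obtain ⟨⟨⟨T, x⟩, hx⟩, hmax⟩ :=
    exists_maximal_of_chains_bounded hchain fun {_ _ _} => Extends.trans
  have htop : T = ⊤ := by
    by_contra hne
    lift T to ℝ using ⟨hne, (EReal.bot_lt_zero.trans hx.pos).ne'⟩
    have hsol : IsSolutionOn g (Ico 0 T) x :=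
      hx.isSolutionOn hw Ico_subset_Ici_self fun t ht => EReal.coe_lt_coe_iff.2 ht.2
    obtain ⟨ζ, hζ, hζx⟩ := hext T x (EReal.coe_pos.1 hx.pos) hsol hx.apply_zero
    obtain ⟨T', y, hy, hTT', hyx⟩ := hx.exists_extension hw hg hW hζ hζx
    exact hTT'.not_ge (hmax ⟨(T', y), hy⟩ ⟨hTT'.le, fun t ht htT =>
      hyx ⟨ht, EReal.coe_lt_coe_iff.1 htT⟩⟩).1
  subst htop
  exact ⟨x, hx.apply_zero, hx.isSolutionOn hw subset_rfl fun t _ => EReal.coe_lt_top t,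
    fun t ht => hx.le t ht (EReal.coe_lt_top t)⟩

end Comparison

section Stability

variable {X : Type*} {k : ℕ} {W : ℕ → X → ℝ} {G : Set X} {Φ : ℝ → X → X}
  {g : (Fin (k + 1) → ℝ) → Fin (k + 1) → ℝ}

lemma lt_of_maxMeasure_lt {u : X} {δ : ℝ} (h : maxMeasure k W u < δ) (i : Fin (k + 1)) :
    W i u < δ :=
  (Finset.sup'_lt_iff _).1 h i (Finset.mem_univ i)

/-- Stability is only assumed for positive initial values, so the dominating solution is started on
the diagonal, at `(c, …, c)` with `max (h₀[u]) 0 < c < δ'`. -/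
lemma IsSubsolution.exists_dominating_solution {u : X} (hΦ₀ : Φ 0 u = u)
    (hsub : IsSubsolution g fun t (i : Fin (k + 1)) => W i (Φ t u))
    (hg : ContinuousOn g (cone (k + 1))) (hW : Wazewski g) {δ δ' : ℝ} (hδ' : 0 < δ') (hδ : δ' ≤ δ)
    (hext : ∀ (T : ℝ) (ξ : ℝ → Fin (k + 1) → ℝ), 0 < T → IsSolutionOn g (Ico 0 T) ξ →
      (∀ i, 0 < ξ 0 i) → ‖ξ 0‖ < δ →
        ∃ η : ℝ → Fin (k + 1) → ℝ, IsSolutionOn g (Ici 0) η ∧ EqOn η ξ (Ico 0 T))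
    (hu : maxMeasure k W u < δ') :
    ∃ ξ : ℝ → Fin (k + 1) → ℝ, IsSolutionOn g (Ici 0) ξ ∧ (∀ i, 0 < ξ 0 i) ∧ ‖ξ 0‖ < δ' ∧
      ∀ t, 0 ≤ t → W 0 (Φ t u) ≤ ξ t 0 := by
  obtain ⟨c, hc, hcδ⟩ := exists_between (max_lt hu hδ')
  have hc₀ : 0 < c := (le_max_right _ _).trans_lt hc
  have hcu : maxMeasure k W u < c := (le_max_left _ _).trans_lt hc
  have hnorm : ‖(fun _ => c : Fin (k + 1) → ℝ)‖ = c := by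
    rw [pi_norm_const, Real.norm_of_nonneg hc₀.le]
  obtain ⟨ξ, hξ₀, hξ, hle⟩ := hsub.exists_solution_ge hg hW (η := fun _ => c)
    (fun i => by simpa only [hΦ₀] using (lt_of_maxMeasure_lt hcu i).le)
    (fun T ξ hT hξ hξ₀ => hext T ξ hT hξ (fun i => by rw [hξ₀]; exact hc₀)
      (by rw [hξ₀, hnorm]; exact hcδ.trans_le hδ))
  exact ⟨ξ, hξ, fun i => by rw [hξ₀]; exact hc₀, by rw [hξ₀, hnorm]; exact hcδ,
    fun t ht => hle t ht 0⟩

theorem XiZeroStable.stableInMeasures (hst : XiZeroStable g) (hg : ContinuousOn g (cone (k + 1)))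
    (hW : Wazewski g) (hΦ₀ : ∀ u ∈ G, Φ 0 u = u)
    (hsub : ∀ u ∈ G, IsSubsolution g fun t (i : Fin (k + 1)) => W i (Φ t u)) :
    StableInMeasures G Φ (maxMeasure k W) (W 0) := fun ε hε => by
  obtain ⟨δ, hδ, hext, hlt⟩ := hst ε hε
  refine ⟨δ, hδ, fun u hu huδ t ht => ?_⟩
  obtain ⟨ξ, hξ, hpos, hnorm, hle⟩ :=
    (hsub u hu).exists_dominating_solution (hΦ₀ u hu) hg hW hδ le_rfl hext huδ
  exact (hle t ht).trans_lt (hlt ξ hξ hpos hnorm t ht)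

theorem AsympXiZeroStable.asympStableInMeasures (hst : AsympXiZeroStable g)
    (hg : ContinuousOn g (cone (k + 1))) (hW : Wazewski g) (hΦ₀ : ∀ u ∈ G, Φ 0 u = u)
    (hsub : ∀ u ∈ G, IsSubsolution g fun t (i : Fin (k + 1)) => W i (Φ t u)) :
    AsympStableInMeasures G Φ (maxMeasure k W) (W 0) := by
  obtain ⟨hst, ρ, hρ, hlim⟩ := hst
  obtain ⟨δ, hδ, hext, -⟩ := hst 1 one_pos
  refine ⟨hst.stableInMeasures hg hW hΦ₀ hsub, min δ ρ, lt_min hδ hρ, fun u hu huδ => ?_⟩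
  obtain ⟨ξ, hξ, hpos, hnorm, hle⟩ := (hsub u hu).exists_dominating_solution (hΦ₀ u hu) hg hW
    (lt_min hδ hρ) (min_le_left δ ρ) hext huδ
  refine squeeze_zero' ?_ ?_ (hlim ξ hξ hpos (hnorm.trans_le (min_le_right δ ρ)))
  · filter_upwards [eventually_ge_atTop 0] with t ht using (hsub u hu).mem_cone t ht 0
  · filter_upwards [eventually_ge_atTop 0] with t ht using hle t ht

lemma IsGlobalSemiflowOn.upperRightDiniLE [MetricSpace X] (hΦ : IsGlobalSemiflowOn G Φ) {u : X}
    (hu : u ∈ G) {v : X → ℝ} {a t : ℝ} (ht : 0 ≤ t)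
    (h : UpperRightDiniLE (fun s => v (Φ s (Φ t u))) a 0) :
    UpperRightDiniLE (fun s => v (Φ s u)) a t := by
  have hadd : ∀ s, 0 ≤ s → v (Φ (t + s) u) = v (Φ s (Φ t u)) := fun s hs => by
    rw [hΦ.add s t hs ht u hu, add_comm]
  exact .of_comp_const_add <| h.of_eventually_le
    (eventually_mem_nhdsWithin.mono fun s (hs : 0 < s) => (hadd s hs.le).le) (hadd 0 le_rfl)

lemma DifferentiableAlongOrbits.upperRightDiniLE {V : X → ℝ} (hV : DifferentiableAlongOrbits G Φ V)
    {u : X} (hu : u ∈ G) : UpperRightDiniLE (fun t => V (Φ t u)) (orbitDeriv Φ V u) 0 :=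
  upperRightDiniLE_of_hasDerivWithinAt (hV u hu).2.hasDerivWithinAt

end Stability

section ComparisonSystem

variable {k : ℕ} {a : ℝ} {φ : ℝ → ℝ} {f : (i : ℕ) → (Fin (i + 1) → ℝ) → ℝ}
  {ψ : (i : ℕ) → (Fin i → ℝ) → ℝ}

lemma continuous_initSeg (i : Fin (k + 1)) :
    Continuous fun ξ : Fin (k + 1) → ℝ => initSeg ξ i :=
  continuous_pi fun _ => continuous_apply _

lemma mapsTo_initSeg (i : Fin (k + 1)) :
    MapsTo (fun ξ : Fin (k + 1) → ℝ => initSeg ξ i) (cone (k + 1)) (cone ((i : ℕ) + 1)) :=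
  fun _ hξ _ => hξ _

lemma one_le_and_le_of_ne_zero {i : Fin (k + 1)} (hi : i ≠ 0) : 1 ≤ (i : ℕ) ∧ (i : ℕ) ≤ k :=
  ⟨Nat.one_le_iff_ne_zero.2 (Fin.val_ne_zero_iff.2 hi), Nat.lt_succ_iff.1 i.2⟩

lemma continuousOn_compRHS (hφ : ContinuousOn φ (Ici 0))
    (hf : ∀ i : ℕ, 1 ≤ i → i ≤ k → ContinuousOn (f i) (cone (i + 1)))
    (hψ : ∀ i : ℕ, 1 ≤ i → i ≤ k → ContinuousOn (ψ i) (cone i)) :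
    ContinuousOn (compRHS k a φ f ψ) (cone (k + 1)) := by
  refine continuousOn_pi.2 fun i => .add ?_ ?_
  · split_ifs with hi
    · have hξ₀ : ContinuousOn (fun ξ : Fin (k + 1) → ℝ => ξ 0) (cone (k + 1)) :=
        (continuous_apply 0).continuousOn
      exact (continuousOn_const.mul (hφ.comp hξ₀ fun ξ hξ => hξ 0)).mul hξ₀
    · obtain ⟨h1i, hik⟩ := one_le_and_le_of_ne_zero hi
      exact (hf i h1i hik).comp (continuous_initSeg i).continuousOn (mapsTo_initSeg i)
  · split_ifs with hi
    · exact ((hψ (i + 1) (Nat.le_add_left 1 _) hi).comp (continuous_initSeg i).continuousOn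
        (mapsTo_initSeg i)).mul (continuous_apply _).continuousOn
    · exact continuousOn_const

lemma compRHS_zero (hk : 1 ≤ k) (ξ : Fin (k + 1) → ℝ) :
    compRHS k a φ f ψ ξ 0 =
      a * φ (ξ 0) * ξ 0 + ψ 1 (fun _ => ξ 0) * ξ ⟨1, Nat.succ_lt_succ hk⟩ := by
  have hseg : initSeg ξ 0 = fun _ => ξ 0 := by
    funext j
    exact congrArg ξ (Fin.ext (Nat.lt_one_iff.1 j.2))
  have hk0 : ((0 : Fin (k + 1)) : ℕ) < k := hk
  rw [compRHS, if_pos rfl, dif_pos hk0, hseg]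
  rfl

lemma isSubsolution_volume {n : ℕ} (hn : 1 ≤ n) (hk : 1 ≤ k)
    {A : EuclideanSpace ℝ (Fin n) →L[ℝ] EuclideanSpace ℝ (Fin n)} {F : ℝ → Conv n → Conv n}
    (hφ : ContinuousOn φ (Ici 0))
    (hF : ContinuousOn (fun q : ℝ × Conv n => F q.1 q.2) (Ici 0 ×ˢ univ))
    {G : Set (Conv n)} {Φ : ℝ → Conv n → Conv n} (hΦ : IsGlobalSemiflowOn G Φ)
    (hΦ_eq : ∀ u ∈ G, SolvesIntegralEq A φ F u (fun t => Φ t u))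
    {W : ℕ → Conv n → ℝ} (hW₀ : W 0 = vol)
    (hW_nonneg : ∀ i : ℕ, 1 ≤ i → i ≤ k → ∀ u ∈ G, 0 ≤ W i u)
    (hW_diff : ∀ i : ℕ, 1 ≤ i → i ≤ k → DifferentiableAlongOrbits G Φ (W i))
    (hineq₀ : ∀ u ∈ G, n * mixedVol 1 u (F (vol u) u) ≤ ψ 1 (fun _ => vol u) * W 1 u)
    (hineq : ∀ i : Fin (k + 1), i ≠ 0 → ∀ u ∈ G, orbitDeriv Φ (W i) u ≤
      compRHS k (LinearMap.trace ℝ _ A.toLinearMap) φ f ψ (fun j => W j u) i)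
    {u : Conv n} (hu : u ∈ G) :
    IsSubsolution (compRHS k (LinearMap.trace ℝ _ A.toLinearMap) φ f ψ)
      fun t (i : Fin (k + 1)) => W i (Φ t u) := by
  refine ⟨continuousOn_pi.2 fun i => ?_, fun t ht i => ?_, fun t ht i => ?_⟩ <;>
    rcases eq_or_ne i 0 with rfl | hi
  · simp only [Fin.val_zero, hW₀]
    exact continuous_vol.comp_continuousOn (hΦ.continuous_time u hu)
  · obtain ⟨h1i, hik⟩ := one_le_and_le_of_ne_zero hi
    exact (hW_diff i h1i hik u hu).1
  · simp only [Fin.val_zero, hW₀]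
    exact vol_nonneg _
  · obtain ⟨h1i, hik⟩ := one_le_and_le_of_ne_zero hi
    exact hW_nonneg i h1i hik _ (hΦ.mapsTo t ht u hu)
  · have hv : Φ t u ∈ G := hΦ.mapsTo t ht u hu
    simp only [Fin.val_zero, hW₀, compRHS_zero hk]
    exact hΦ.upperRightDiniLE hu ht
      (((hΦ_eq _ hv).upperRightDiniLE_vol hn hφ hF).mono (add_le_add_right (hineq₀ _ hv) _))
  · obtain ⟨h1i, hik⟩ := one_le_and_le_of_ne_zero hi
    have hv : Φ t u ∈ G := hΦ.mapsTo t ht u hu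
    exact hΦ.upperRightDiniLE hu ht
      (((hW_diff i h1i hik).upperRightDiniLE hv).mono (hineq i hi _ hv))

end ComparisonSystem

end ConvSemiflow

theorem theorem4p4_general (n k : ℕ) (hn : 1 ≤ n) (hk : 1 ≤ k)
    (A : EuclideanSpace ℝ (Fin n) →L[ℝ] EuclideanSpace ℝ (Fin n))
    (φ : ℝ → ℝ) (hφ : ContinuousOn φ (Ici 0))
    (F : ℝ → Conv n → Conv n)
    (hF : ContinuousOn (fun q : ℝ × Conv n => F q.1 q.2) (Ici 0 ×ˢ univ))
    (G : Set (Conv n)) (Φ : ℝ → Conv n → Conv n) (hΦ : IsGlobalSemiflowOn G Φ)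
    (hΦ_eq : ∀ u ∈ G, SolvesIntegralEq A φ F u (fun t => Φ t u))
    (W : ℕ → Conv n → ℝ) (hW0 : ∀ u, W 0 u = vol u)
    (hW_nonneg : ∀ i : ℕ, 1 ≤ i → i ≤ k → ∀ u ∈ G, 0 ≤ W i u)
    (hW_diff : ∀ i : ℕ, 1 ≤ i → i ≤ k → DifferentiableAlongOrbits G Φ (W i))
    (f : (i : ℕ) → (Fin (i + 1) → ℝ) → ℝ)
    (hf : ∀ i : ℕ, 1 ≤ i → i ≤ k → ContinuousOn (f i) (cone (i + 1)))
    (ψ : (i : ℕ) → (Fin i → ℝ) → ℝ)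
    (hψ : ∀ i : ℕ, 1 ≤ i → i ≤ k → ContinuousOn (ψ i) (cone i))
    (hineq₀ : ∀ u ∈ G, n * mixedVol 1 u (F (vol u) u) ≤ ψ 1 (fun _ => vol u) * W 1 u)
    (hineq : ∀ i : Fin (k + 1), i ≠ 0 → ∀ u ∈ G,
      orbitDeriv Φ (W i) u ≤
        compRHS k (LinearMap.trace ℝ _ A.toLinearMap) φ f ψ (fun j => W j u) i)
    (hWaz : Wazewski (compRHS k (LinearMap.trace ℝ _ A.toLinearMap) φ f ψ)) :
    (XiZeroStable (compRHS k (LinearMap.trace ℝ _ A.toLinearMap) φ f ψ) →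
      StableInMeasures G Φ (maxMeasure k W) vol) ∧
    (AsympXiZeroStable (compRHS k (LinearMap.trace ℝ _ A.toLinearMap) φ f ψ) →
      AsympStableInMeasures G Φ (maxMeasure k W) vol) := by
  have hvol : W 0 = vol := funext hW0
  have hrhs := continuousOn_compRHS (a := LinearMap.trace ℝ _ A.toLinearMap) hφ hf hψ
  have hsub := fun u (hu : u ∈ G) =>
    isSubsolution_volume hn hk hφ hF hΦ hΦ_eq hvol hW_nonneg hW_diff hineq₀ hineq hu
  rw [← hvol]
  exact ⟨fun hst => hst.stableInMeasures hrhs hWaz hΦ.zero hsub,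
    fun hst => hst.asympStableInMeasures hrhs hWaz hΦ.zero hsub⟩

theorem theorem4p4 (n k : ℕ) (hn : 1 ≤ n) (hk : 1 ≤ k)
    -- the data of the semiflow
    (A : EuclideanSpace ℝ (Fin n) →L[ℝ] EuclideanSpace ℝ (Fin n))
    (φ : ℝ → ℝ) (hφ_nonneg : ∀ s : ℝ, 0 ≤ s → 0 ≤ φ s) (hφ_lip : LocallyLipschitzOn (Ici 0) φ)
    (F : ℝ → Conv n → Conv n)
    (hF_lip : LocallyLipschitzOn (Ici (0 : ℝ) ×ˢ (univ : Set (Conv n))) (fun q => F q.1 q.2))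
    -- the global semiflow of the integral equation on the closed set G, with the fixed point {0}
    (G : Set (Conv n)) (hG : IsClosed G) (hG0 : (0 : Conv n) ∈ G)
    (Φ : ℝ → Conv n → Conv n) (hΦ : IsGlobalSemiflowOn G Φ)
    (hΦ_eq : ∀ u ∈ G, SolvesIntegralEq A φ F u (fun t => Φ t u))
    (hΦ0 : ∀ t : ℝ, 0 ≤ t → Φ t 0 = 0)
    -- the functionals W_0 = V, W_1, ..., W_k and the functions f_1, ..., f_k, psi_1, ..., psi_k
    (W : ℕ → Conv n → ℝ) (hW0 : ∀ u, W 0 u = vol u)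
    (hW_nonneg : ∀ i : ℕ, 1 ≤ i → i ≤ k → ∀ u ∈ G, 0 ≤ W i u)
    (hW_diff : ∀ i : ℕ, 1 ≤ i → i ≤ k → DifferentiableAlongOrbits G Φ (W i))
    (f : (i : ℕ) → (Fin (i + 1) → ℝ) → ℝ)
    (hf : ∀ i : ℕ, 1 ≤ i → i ≤ k → ContinuousOn (f i) (cone (i + 1)))
    (ψ : (i : ℕ) → (Fin i → ℝ) → ℝ)
    (hψ : ∀ i : ℕ, 1 ≤ i → i ≤ k → ContinuousOn (ψ i) (cone i))
    -- the differential inequalities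
    (hineq₀ : ∀ u ∈ G, n * mixedVol 1 u (F (vol u) u) ≤ ψ 1 (fun _ => vol u) * W 1 u)
    (hineq : ∀ i : Fin (k + 1), i ≠ 0 → ∀ u ∈ G,
      orbitDeriv Φ (W i) u ≤
        compRHS k (LinearMap.trace ℝ _ A.toLinearMap) φ f ψ (fun j => W j u) i)
    -- the comparison system
    (hWaz : Wazewski (compRHS k (LinearMap.trace ℝ _ A.toLinearMap) φ f ψ))
    (hzero : compRHS k (LinearMap.trace ℝ _ A.toLinearMap) φ f ψ 0 = 0) :
    (XiZeroStable (compRHS k (LinearMap.trace ℝ _ A.toLinearMap) φ f ψ) →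
      StableInMeasures G Φ (maxMeasure k W) vol) ∧
    (AsympXiZeroStable (compRHS k (LinearMap.trace ℝ _ A.toLinearMap) φ f ψ) →
      AsympStableInMeasures G Φ (maxMeasure k W) vol) := by
  exact theorem4p4_general n k hn hk A φ hφ_lip.continuousOn F hF_lip.continuousOn G Φ hΦ hΦ_eq
    W hW0 hW_nonneg hW_diff f hf ψ hψ hineq₀ hineq hWaz
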